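/- Let $K\subset\mathbb{R}^2$ be a closed, bounded, strictly convex domain enclosed by a smooth ($C^\infty$) simple closed curve $\gamma$ of positive curvature. Let $p_K(\theta)=\max_{x\in K}\langle x,(\cos\theta,\sin\theta)\rangle$ be its support function, and parametrize $\gamma$ by the angle $\theta$ of the outward normal, $\gamma(\theta)=p_K(\theta)(\cos\theta,\sin\theta)+p_K'(\theta)(-\sin\theta,\cos\theta)$. Let $\kappa(\theta)>0$ and $\rho(\theta)=1/\kappa(\theta)$ be the curvature and the curvature radius of $\gamma$, $\rho_M$ and $\rho_m$ the maximum and the minimum of $\rho$, $L$ the length of $\gamma$, $A$ the area of $K$, $\rho_e$ and $\rho_i$ the circumradius and the inradius of $K$. Let $\beta(\theta)=\gamma(\theta)-\rho(\theta)(\cos\theta,\sin\theta)$ be the locus of the curvature centers of $\gamma$, $\tilde A=\frac12\oint_\beta \beta_1\,\mathrm{d}\beta_2-\beta_2\,\mathrm{d}\beta_1$ the oriented area enclosed by $\beta$, and $\rho_\beta(\theta)=|p_K'(\theta)+p_K'''(\theta)|$ the curvature radius of $\beta$, that is, the absolute value of the reciprocal of the curvature of $\beta$ (taken to be $0$ at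 the singular points $\beta'(\theta)=0$). (i) The following inequalities hold: $$2L^2+8|\tilde A|+2\int_0^{2\pi}\rho_\beta(\theta)^2\,\mathrm{d}\theta+\oint_\gamma\kappa^2\,\mathrm{d}s\ \ge\ 20A,\tag{a}$$ $$3\int_0^{2\pi}\rho(\theta)^2\,\mathrm{d}\theta+(32\pi-38)A+(\pi-1)\int_0^{2\pi}\rho_\beta(\theta)^2\,\mathrm{d}\theta\ \ge\ \frac{8\pi-8}{\pi}L^2+(8-2\pi)|\tilde A|,\tag{b}$$ $$\int_0^{2\pi}\rho(\theta)^2\,\mathrm{d}\theta+\Big(\frac{52\pi}{7}-2\Big)A+\frac34\int_0^{2\pi}\rho_\beta(\theta)^2\,\mathrm{d}\theta\ \ge\ \frac{13}{7}L^2+\frac{\pi}{7}|\tilde A|,\tag{c}$$ and, for every $\epsilon\in[0,\frac12]$, $$|\tilde A|+\epsilon\int_0^{2\pi}\rho_\beta(\theta)^2\,\mathrm{d}\theta+\pi(\rho_M-\rho_m)^2\ \ge\ 2\pi(\rho_e-\rho_i)^2.\tag{d}$$ (ii) Inequality (a) is always strict. (iii) Equality holds in (b) and in (c) if $K$ is a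 disk. (iv) For every $\epsilon\in[0,\frac12]$, equality holds in (d) if and only if $K$ is a disk. -/

import Mathlib

open Real Set
open scoped ContDiff

noncomputable section

namespace PlaneConvex

/-- The Euclidean plane, with its Euclidean norm and Lebesgue measure. -/
abbrev Plane : Type := EuclideanSpace ℝ (Fin 2)

/-! ### Parametrised plane curves -/

/-- The signed curvature `(c₁' c₂'' - c₂' c₁'') / |c'|³` of a parametrised plane curve. -/
def curvature (c : ℝ → Plane) (t : ℝ) : ℝ :=
  (deriv c t 0 * deriv (deriv c) t 1 - deriv c t 1 * deriv (deriv c) t 0) / ‖deriv c t‖ ^ 3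

/-- The length `∮ ds` of a `2π`-periodic closed curve. -/
def length (c : ℝ → Plane) : ℝ := ∫ t in (0 : ℝ)..2 * π, ‖deriv c t‖

/-- The line integral `∮ f ds` along a `2π`-periodic closed curve. -/
def lineIntegral (c : ℝ → Plane) (f : ℝ → ℝ) : ℝ :=
  ∫ t in (0 : ℝ)..2 * π, f t * ‖deriv c t‖

/-- The oriented area `½ ∮ c₁ dc₂ - c₂ dc₁` enclosed by a `2π`-periodic closed curve. -/
def orientedArea (c : ℝ → Plane) : ℝ :=
  1 / 2 * ∫ t in (0 : ℝ)..2 * π, (c t 0 * deriv c t 1 - c t 1 * deriv c t 0)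

/-! ### The domains -/

/-- A closed strictly convex plane domain `K` enclosed by a smooth simple closed curve of positive
curvature (with respect to some, hence any, regular counterclockwise parametrisation). -/
structure IsSmoothStrictlyConvexDomain (K : Set Plane) : Prop where
  isCompact : IsCompact K
  strictConvex : StrictConvex ℝ K
  nonempty_interior : (interior K).Nonempty
  smooth_boundary : ∃ c : ℝ → Plane,
    ContDiff ℝ ∞ c ∧ Function.Periodic c (2 * π) ∧ InjOn c (Ico 0 (2 * π)) ∧
      (∀ t, deriv c t ≠ 0) ∧ (∀ t, 0 < curvature c t) ∧ range c = frontier K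

/-- `K` is a (closed, nondegenerate) disk. -/
def IsDisk (K : Set Plane) : Prop :=
  ∃ (z : Plane) (r : ℝ), 0 < r ∧ K = Metric.closedBall z r

/-! ### Geometric quantities of a domain -/

/-- The unit vector `(cos θ, sin θ)`; it is the outward normal at the boundary point with
normal angle `θ`. -/
def outwardNormal (θ : ℝ) : Plane := !₂[cos θ, sin θ]

/-- The support function `p_K(θ) = max_{x ∈ K} ⟨x, (cos θ, sin θ)⟩`. -/
def supportFunction (K : Set Plane) (θ : ℝ) : ℝ :=
  sSup ((fun x : Plane => inner ℝ x (outwardNormal θ)) '' K)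

/-- The boundary curve `γ` of `K`, parametrised by the angle `θ` of the outward normal. -/
def boundaryCurve (K : Set Plane) (θ : ℝ) : Plane :=
  !₂[supportFunction K θ * cos θ - deriv (supportFunction K) θ * sin θ,
     supportFunction K θ * sin θ + deriv (supportFunction K) θ * cos θ]

/-- The curvature `κ(θ)` of the boundary curve. -/
def kappa (K : Set Plane) (θ : ℝ) : ℝ := curvature (boundaryCurve K) θ

/-- The curvature radius `ρ(θ) = 1 / κ(θ)` of the boundary curve. -/
def rho (K : Set Plane) (θ : ℝ) : ℝ := 1 / kappa K θ

/-- The locus `β` of the curvature centers of the boundary curve: `β = γ + ρ N`, with `N` the unit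
inward normal. -/
def evolute (K : Set Plane) (θ : ℝ) : Plane :=
  boundaryCurve K θ + rho K θ • (-outwardNormal θ)

/-- The curvature radius `ρ_β(θ) = |1 / κ_β(θ)|` of `β`. It equals `|p_K'(θ) + p_K'''(θ)|` for every
`θ`: at the cusps of `β`, where `β'(θ) = 0`, both sides are `0` by the convention `x / 0 = 0`. -/
def rhoBeta (K : Set Plane) (θ : ℝ) : ℝ := |1 / curvature (evolute K) θ|

/-- The length `L` of the boundary curve. -/
def perimeter (K : Set Plane) : ℝ := length (boundaryCurve K)

/-- The area `A` of `K`. -/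
def area (K : Set Plane) : ℝ := MeasureTheory.volume.real K

/-- The oriented area `Ã` of the domain enclosed by `β`. -/
def evoluteArea (K : Set Plane) : ℝ := orientedArea (evolute K)

/-- `∫₀^{2π} ρ(θ)² dθ`. -/
def intRhoSq (K : Set Plane) : ℝ := ∫ θ in (0 : ℝ)..2 * π, rho K θ ^ 2

/-- `∫₀^{2π} ρ_β(θ)² dθ`. -/
def intRhoBetaSq (K : Set Plane) : ℝ := ∫ θ in (0 : ℝ)..2 * π, rhoBeta K θ ^ 2

/-- `∮_γ κ² ds`. -/
def intKappaSq (K : Set Plane) : ℝ := lineIntegral (boundaryCurve K) (fun θ => kappa K θ ^ 2)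

/-- The circumradius `ρ_e`: the smallest radius of a disk containing `K`. -/
def circumradius (K : Set Plane) : ℝ :=
  sInf {r : ℝ | 0 ≤ r ∧ ∃ z : Plane, K ⊆ Metric.closedBall z r}

/-- The inradius `ρ_i`: the largest radius of a disk contained in `K`. -/
def inradius (K : Set Plane) : ℝ :=
  sSup {r : ℝ | 0 ≤ r ∧ ∃ z : Plane, Metric.closedBall z r ⊆ K}

/-- The maximum `ρ_M` of the curvature radius of the boundary curve. -/
def rhoMax (K : Set Plane) : ℝ := sSup (rho K '' Icc 0 (2 * π))

/-- The minimum `ρ_m` of the curvature radius of the boundary curve. -/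
def rhoMin (K : Set Plane) : ℝ := sInf (rho K '' Icc 0 (2 * π))

end PlaneConvex

end

open PlaneConvex

/-! Everything is read off from the Fourier coefficients `c_n` of the support function `p`.
Parametrizing the boundary by normal angle gives `γ' = ρ T` with `ρ = p + p''`, and `β' = -ρ' N`.
With `M_k` the mean of the square of the `k`-th derivative of `p`, that is `M_k = ∑ n^(2k) |c_n|²`,
integration by parts yields `L² = 4π² |c_0|²`, `A = π (M_0 - M_1)`, `|Ã| = π (M_2 - M_1)`, `∫ρ² = 2π
(M_0 - 2 M_1 + M_2)` and `∫ρ_β² = 2π (M_1 - 2 M_2 + M_3)`.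

Hence (b) and (c) amount to the nonnegativity of a cubic polynomial in `m = n²` at `m = 1` and for
`m ≥ 4`; the harmonic `n = 0` cancels against `L²` (`coeff_zero_le_meanSq`). The isoperimetric
inequality is the case `m - 1 ≥ 0`, and (a) follows from it because `4π > 12`.

For (d), let `d = ρ_e - ρ_i`. On one side `d ≤ ρ_M - ρ_m`: by Sturm comparison
(`nonneg_of_add_deriv2_nonneg`) `K` lies in a disk of radius `ρ_M` and contains one of radius `ρ_m`.
On the other side `d` is at most the oscillation of `p` about a center that removes the first
harmonics, and Cauchy–Schwarz against `∑ n⁻⁴` over `|n| ≥ 2` bounds the square of this oscillation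
by `(9/10)(M_2 - M_1)` (`sq_hasSum_le`), so `|Ã| ≥ (10/9) π d²`. Adding the two gives (d). Because
`10/9 > 1`, equality forces `d = 0`, then `ρ_M = ρ_m`, and constant `ρ` makes the evolute a point
and `K` a disk. -/

noncomputable section

namespace PlaneConvex

open MeasureTheory

/-! ### The plane and its rotating orthonormal frame -/

/-- The unit vector `(-sin θ, cos θ)`, tangent to the boundary at normal angle `θ`. -/
def unitTangent (θ : ℝ) : Plane := !₂[-sin θ, cos θ]

theorem hasDerivAt_plane_iff {c : ℝ → Plane} {v : Plane} {t : ℝ} :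
    HasDerivAt c v t ↔
      HasDerivAt (fun s => c s 0) (v 0) t ∧ HasDerivAt (fun s => c s 1) (v 1) t := by
  constructor
  · intro h
    exact ⟨(EuclideanSpace.proj (𝕜 := ℝ) (0 : Fin 2)).hasFDerivAt.comp_hasDerivAt t h,
      (EuclideanSpace.proj (𝕜 := ℝ) (1 : Fin 2)).hasFDerivAt.comp_hasDerivAt t h⟩
  · rintro ⟨h0, h1⟩
    rw [hasDerivAt_iff_hasFDerivAt, ← hasFDerivWithinAt_univ, hasFDerivWithinAt_euclidean]
    intro i
    rw [hasFDerivWithinAt_univ]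
    rw [hasDerivAt_iff_hasFDerivAt] at h0 h1
    fin_cases i
    · exact HasFDerivAt.congr_fderiv h0 (by ext; simp)
    · exact HasFDerivAt.congr_fderiv h1 (by ext; simp)

theorem HasDerivAt.plane {f g : ℝ → ℝ} {f' g' t : ℝ} (hf : HasDerivAt f f' t)
    (hg : HasDerivAt g g' t) : HasDerivAt (fun s => (!₂[f s, g s] : Plane)) !₂[f', g'] t :=
  hasDerivAt_plane_iff.2 ⟨by simpa using hf, by simpa using hg⟩

theorem inner_plane (x y : Plane) : inner ℝ x y = x 0 * y 0 + x 1 * y 1 := by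
  simp [PiLp.inner_apply, Fin.sum_univ_two, mul_comm]

theorem norm_sq_plane (x : Plane) : ‖x‖ ^ 2 = x 0 ^ 2 + x 1 ^ 2 := by
  rw [EuclideanSpace.norm_sq_eq, Fin.sum_univ_two]; simp

theorem plane_ext {x y : Plane} (h0 : x 0 = y 0) (h1 : x 1 = y 1) : x = y := by
  ext i; fin_cases i
  · exact h0
  · exact h1

@[simp] theorem norm_outwardNormal (θ : ℝ) : ‖outwardNormal θ‖ = 1 := by
  have h := norm_sq_plane (outwardNormal θ)
  simp only [outwardNormal, PiLp.toLp_apply, Matrix.cons_val_zero, Matrix.cons_val_one] at h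
  rw [cos_sq_add_sin_sq] at h
  exact (pow_eq_one_iff_of_nonneg (norm_nonneg _) two_ne_zero).1 h

@[simp] theorem norm_unitTangent (θ : ℝ) : ‖unitTangent θ‖ = 1 := by
  have h := norm_sq_plane (unitTangent θ)
  simp only [unitTangent, PiLp.toLp_apply, Matrix.cons_val_zero, Matrix.cons_val_one] at h
  rw [neg_sq, sin_sq_add_cos_sq] at h
  exact (pow_eq_one_iff_of_nonneg (norm_nonneg _) two_ne_zero).1 h

theorem hasDerivAt_outwardNormal (θ : ℝ) : HasDerivAt outwardNormal (unitTangent θ) θ :=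
  HasDerivAt.plane (hasDerivAt_cos θ) (hasDerivAt_sin θ)

theorem hasDerivAt_unitTangent (θ : ℝ) : HasDerivAt unitTangent (-outwardNormal θ) θ := by
  refine (HasDerivAt.plane (hasDerivAt_sin θ).fun_neg (hasDerivAt_cos θ)).congr_deriv ?_
  apply plane_ext <;> simp [outwardNormal]

theorem contDiff_plane {f g : ℝ → ℝ} {n : WithTop ℕ∞} (hf : ContDiff ℝ n f) (hg : ContDiff ℝ n g) :
    ContDiff ℝ n (fun s => (!₂[f s, g s] : Plane)) := by
  rw [contDiff_euclidean]
  intro i; fin_cases i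
  · simpa using hf
  · simpa using hg

theorem contDiff_outwardNormal : ContDiff ℝ ∞ outwardNormal :=
  contDiff_plane contDiff_cos contDiff_sin

theorem exists_eq_norm_smul_outwardNormal (v : Plane) : ∃ θ, v = ‖v‖ • outwardNormal θ := by
  refine ⟨Complex.arg ⟨v 0, v 1⟩, ?_⟩
  have hn : ‖v‖ = ‖(⟨v 0, v 1⟩ : ℂ)‖ := by
    rw [← sq_eq_sq₀ (norm_nonneg _) (norm_nonneg _), norm_sq_plane, Complex.sq_norm,
      Complex.normSq_mk]
    ring
  rw [hn]
  apply plane_ext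
  · simp [outwardNormal]
  · simp [outwardNormal]

theorem outwardNormal_periodic : Function.Periodic outwardNormal (2 * π) := fun θ => by
  simp [outwardNormal]

/-! ### Parametrization of the boundary by the normal angle -/

/-- A smooth nowhere vanishing plane vector field along the line has a smooth angle function. -/
theorem exists_smooth_angle {x y : ℝ → ℝ} (hx : ContDiff ℝ ∞ x) (hy : ContDiff ℝ ∞ y)
    (h : ∀ t, x t ^ 2 + y t ^ 2 ≠ 0) :
    ∃ r φ : ℝ → ℝ, ContDiff ℝ ∞ φ ∧ (∀ t, 0 < r t) ∧ (∀ t, x t = r t * cos (φ t)) ∧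
      (∀ t, y t = r t * sin (φ t)) ∧
      ∀ t, HasDerivAt φ ((x t * deriv y t - y t * deriv x t) / (x t ^ 2 + y t ^ 2)) t := by
  set z : ℝ → ℂ := fun t => ⟨x t, y t⟩ with hz
  have hx' := contDiff_infty_iff_deriv.1 hx
  have hy' := contDiff_infty_iff_deriv.1 hy
  set w : ℝ → ℂ := fun t => ⟨deriv x t, deriv y t⟩ with hw
  have mk_eq : ∀ f g : ℝ → ℝ, (fun t => (⟨f t, g t⟩ : ℂ)) =
      fun t => (f t : ℂ) + (g t : ℂ) * Complex.I := by
    intro f g; ext t; exact Complex.mk_eq_add_mul_I _ _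
  have hzd : ∀ t, HasDerivAt z (w t) t := by
    intro t
    have := ((hx'.1 t).hasDerivAt.ofReal_comp).fun_add
      (((hy'.1 t).hasDerivAt.ofReal_comp).mul_const Complex.I)
    rw [← mk_eq] at this
    exact this.congr_deriv (Complex.mk_eq_add_mul_I _ _).symm
  have hofReal : ∀ f : ℝ → ℝ, ContDiff ℝ ∞ f → ContDiff ℝ ∞ fun t => (f t : ℂ) := fun f hf =>
    Complex.ofRealCLM.contDiff.comp hf
  have hzc : ContDiff ℝ ∞ z := by
    rw [hz, mk_eq]
    exact (hofReal _ hx).add ((hofReal _ hy).mul contDiff_const)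
  have hwc : ContDiff ℝ ∞ w := by
    rw [hw, mk_eq]
    exact (hofReal _ hx'.2).add ((hofReal _ hy'.2).mul contDiff_const)
  have hz0 : ∀ t, z t ≠ 0 := by
    intro t h0
    have h1 := congrArg Complex.re h0
    have h2 := congrArg Complex.im h0
    simp only [hz, Complex.zero_re, Complex.zero_im] at h1 h2
    exact h t (by rw [h1, h2]; ring)
  have hqc : ContDiff ℝ ∞ (fun t => w t / z t) := by
    simp only [div_eq_mul_inv]
    exact hwc.mul (hzc.inv hz0)
  -- A continuous logarithm of `z`, built by integrating `z'/z`; its imaginary part is the angle,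
  -- and no branch cut interferes.
  set f : ℝ → ℂ := fun t => Complex.log (z 0) + ∫ s in (0 : ℝ)..t, w s / z s with hf
  have hfd : ∀ t, HasDerivAt f (w t / z t) t := fun t =>
    (intervalIntegral.integral_hasDerivAt_right (hqc.continuous.intervalIntegrable _ _)
      (hqc.continuous.stronglyMeasurableAtFilter _ _) hqc.continuous.continuousAt).const_add _
  have hfc : ContDiff ℝ ∞ f := by
    rw [contDiff_infty_iff_deriv]
    refine ⟨fun t => (hfd t).differentiableAt, ?_⟩
    rwa [show deriv f = fun t => w t / z t from funext fun t => (hfd t).deriv]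
  have hexp : ∀ t, Complex.exp (f t) = z t := by
    have hd : ∀ t, HasDerivAt (fun t => z t * Complex.exp (-f t)) 0 t := by
      intro t
      have := (hzd t).mul ((hfd t).neg.cexp)
      refine this.congr_deriv ?_
      have := hz0 t
      field_simp
      ring
    intro t
    have hc := is_const_of_deriv_eq_zero (fun t => (hd t).differentiableAt)
      (fun t => (hd t).deriv) t 0
    have h0 : f 0 = Complex.log (z 0) := by simp [hf]
    simp only [h0, Complex.exp_neg, Complex.exp_log (hz0 0)] at hc
    rw [mul_inv_cancel₀ (hz0 0)] at hc
    have he := Complex.exp_ne_zero (f t)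
    field_simp at hc
    exact hc.symm
  refine ⟨fun t => Real.exp (f t).re, fun t => (f t).im, Complex.imCLM.contDiff.comp hfc,
    fun t => Real.exp_pos _, fun t => ?_, fun t => ?_, fun t => ?_⟩
  · rw [← Complex.exp_re, hexp]
  · rw [← Complex.exp_im, hexp]
  · refine (Complex.imCLM.hasFDerivAt.comp_hasDerivAt t (hfd t)).congr_deriv ?_
    simp only [Complex.imCLM_apply, Complex.div_im, hz, hw, Complex.normSq_mk]
    rw [← sub_div]
    congr 1 <;> ring

/-- A function with periodic, continuous, positive derivative is onto. -/
theorem surjective_of_periodic_deriv_pos {φ g : ℝ → ℝ} {T : ℝ} (hT : 0 < T)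
    (hd : ∀ t, HasDerivAt φ (g t) t) (hg : Continuous g) (hper : Function.Periodic g T)
    (hpos : ∀ t, 0 < g t) : Function.Surjective φ := by
  obtain ⟨m, -, hm⟩ := isCompact_Icc.exists_isMinOn (nonempty_Icc.2 hT.le)
    (hg.continuousOn (s := Icc 0 T))
  have hδ : ∀ t, g m ≤ g t := by
    intro t
    obtain ⟨s, hs, hst⟩ := hper.exists_mem_Ico₀ hT t
    rw [hst]
    exact hm ⟨hs.1, hs.2.le⟩
  -- The derivative is bounded below by its positive minimum over one period, so `φ` grows at least
  -- linearly in both directions.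
  have hmono : Monotone fun t => φ t - g m * t := by
    refine monotone_of_hasDerivAt_nonneg (f' := fun t => g t - g m) (fun t => ?_)
      (fun t => sub_nonneg.2 (hδ t))
    simpa using (hd t).fun_sub ((hasDerivAt_id t).const_mul (g m))
  have hcont : Continuous φ := continuous_iff_continuousAt.2 fun t => (hd t).continuousAt
  refine hcont.surjective ?_ ?_
  · refine Filter.tendsto_atTop_mono' (f₁ := fun t => g m * t + φ 0) _ ?_ ?_
    · filter_upwards [Filter.eventually_ge_atTop 0] with t ht
      have := hmono ht
      simp only [mul_zero, sub_zero] at this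
      linarith
    · exact Filter.tendsto_atTop_add_const_right _ _
        (Filter.tendsto_id.const_mul_atTop (hpos m))
  · refine Filter.tendsto_atBot_mono' (f₁ := fun t => g m * t + φ 0) _ ?_ ?_
    · filter_upwards [Filter.eventually_le_atBot 0] with t ht
      have := hmono ht
      simp only [mul_zero, sub_zero] at this
      linarith
    · exact Filter.tendsto_atBot_add_const_right _ _
        (Filter.tendsto_id.const_mul_atBot (hpos m))

/-- A positive derivative makes `φ` a diffeomorphism of the line; the inverse serves to
reparametrize the boundary by normal angle. -/
theorem exists_smooth_inverse {φ g : ℝ → ℝ} (hφ : ContDiff ℝ ∞ φ)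
    (hd : ∀ t, HasDerivAt φ (g t) t) (hpos : ∀ t, 0 < g t) (hs : Function.Surjective φ) :
    ∃ τ : ℝ → ℝ, ContDiff ℝ ∞ τ ∧ (∀ θ, φ (τ θ) = θ) ∧ (∀ t, τ (φ t) = t) ∧
      ∀ θ, HasDerivAt τ (g (τ θ))⁻¹ θ := by
  have hm : StrictMono φ := strictMono_of_hasDerivAt_pos hd hpos
  set e := (hm.orderIsoOfSurjective φ hs).toHomeomorph with he
  have hee : ⇑e = φ := rfl
  have hc : ContDiff ℝ ∞ e.symm :=
    e.contDiff_symm_deriv (fun t => (hpos t).ne') (by simpa [hee] using hd) (by simpa [hee] using hφ)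
  have h1 : ∀ θ, φ (e.symm θ) = θ := fun θ => e.apply_symm_apply θ
  refine ⟨e.symm, hc, h1, fun t => e.symm_apply_apply t, fun θ => ?_⟩
  exact HasDerivAt.of_local_left_inverse hc.continuous.continuousAt (hd _) (hpos _).ne'
    (Filter.Eventually.of_forall h1)

/-- At a local maximum with vanishing first derivative the second derivative is not positive. -/
theorem deriv_deriv_nonpos_of_isLocalMax {f : ℝ → ℝ} {t : ℝ} (h : IsLocalMax f t)
    (hc : ContinuousAt f t) : deriv (deriv f) t ≤ 0 := by
  by_contra! hp
  -- A positive second derivative would make `t` a local minimum too, hence `f` locally constant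
  -- with zero second derivative.
  have hmin := isLocalMin_of_deriv_deriv_pos hp h.deriv_eq_zero hc
  have he : f =ᶠ[nhds t] fun _ => f t := by
    filter_upwards [h, hmin] with s h1 h2 using le_antisymm h1 h2
  have := he.deriv.deriv_eq
  simp at this
  exact hp.ne' this

theorem curvature_mul_norm_cube {c : ℝ → Plane} {t : ℝ} (h : deriv c t ≠ 0) :
    deriv c t 0 * deriv (deriv c) t 1 - deriv c t 1 * deriv (deriv c) t 0 =
      curvature c t * ‖deriv c t‖ ^ 3 := by
  rw [curvature, div_mul_cancel₀ _ (pow_ne_zero 3 (norm_ne_zero_iff.2 h))]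

theorem HasDerivAt.inner_const_right {c : ℝ → Plane} {c' : Plane} {t : ℝ} (h : HasDerivAt c c' t)
    (v : Plane) : HasDerivAt (fun s => inner ℝ (c s) v) (inner ℝ c' v) t := by
  simpa using h.inner ℝ (hasDerivAt_const t v)

/-- At a boundary point `c t` the outward normal of the parametrisation supports `K`. -/
theorem inner_le_of_tangent_angle {K : Set Plane} (hconv : Convex ℝ K) (hcl : IsClosed K)
    (hint : (interior K).Nonempty) {c : ℝ → Plane} (hc : ContDiff ℝ ∞ c)
    (hr : range c = frontier K) {t r φ : ℝ} (hr0 : 0 < r) (hd : deriv c t = r • unitTangent φ)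
    (hcurv : 0 < deriv c t 0 * deriv (deriv c) t 1 - deriv c t 1 * deriv (deriv c) t 0) :
    ∀ x ∈ K, inner ℝ x (outwardNormal φ) ≤ inner ℝ (c t) (outwardNormal φ) := by
  have hfr : ∀ s, c s ∈ frontier K := fun s => hr ▸ mem_range_self s
  -- Hahn–Banach provides some supporting direction `v`. The first-order condition makes it a
  -- multiple `l` of the normal, and the second-order condition together with positive curvature
  -- forces `l > 0`.
  obtain ⟨f, hf0, hf⟩ := geometric_hahn_banach_of_nonempty_interior_point (x := c t) hconv
    (hfr t).2 hint
  set v : Plane := (InnerProductSpace.toDual ℝ Plane).symm f with hv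
  have hfv : ∀ x, f x = inner ℝ x v := fun x => by
    rw [real_inner_comm, hv, InnerProductSpace.toDual_symm_apply]
  have hv0 : v ≠ 0 := by simpa [hv] using hf0
  have hc1 := contDiff_infty_iff_deriv.1 hc
  have hc2 := contDiff_infty_iff_deriv.1 hc1.2
  have hD : ∀ s, HasDerivAt (fun s => inner ℝ (c s) v) (inner ℝ (deriv c s) v) s := fun s =>
    HasDerivAt.inner_const_right (hc1.1 s).hasDerivAt v
  have hD2 : HasDerivAt (fun s => inner ℝ (deriv c s) v) (inner ℝ (deriv (deriv c) t) v) t :=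
    HasDerivAt.inner_const_right (hc2.1 t).hasDerivAt v
  have hmax : IsLocalMax (fun s => inner ℝ (c s) v) t :=
    Filter.Eventually.of_forall fun s => by
      simpa only [hfv] using hf _ (hcl.frontier_subset (hfr s))
  have h1 : inner ℝ (deriv c t) v = 0 := by
    rw [← (hD t).deriv]; exact hmax.deriv_eq_zero
  have h2 : inner ℝ (deriv (deriv c) t) v ≤ 0 := by
    have := deriv_deriv_nonpos_of_isLocalMax hmax (hD t).continuousAt
    rwa [show deriv (fun s => inner ℝ (c s) v) = fun s => inner ℝ (deriv c s) v from
      funext fun s => (hD s).deriv, hD2.deriv] at this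
  set w := deriv (deriv c) t
  rw [hd] at h1 hcurv
  simp only [inner_plane, unitTangent, PiLp.smul_apply, Matrix.cons_val_zero,
    Matrix.cons_val_one, smul_eq_mul] at h1 h2 hcurv
  set l := v 0 * cos φ + v 1 * sin φ with hl
  have h1' : -sin φ * v 0 + cos φ * v 1 = 0 := by
    have : r * (-sin φ * v 0 + cos φ * v 1) = 0 := by linarith
    exact (mul_eq_zero.1 this).resolve_left hr0.ne'
  have hsc := sin_sq_add_cos_sq φ
  have e0 : v 0 = l * cos φ := by
    rw [hl]; linear_combination (-v 0) * hsc - sin φ * h1'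
  have e1 : v 1 = l * sin φ := by
    rw [hl]; linear_combination (-v 1) * hsc + cos φ * h1'
  have hw : w 0 * cos φ + w 1 * sin φ < 0 := by
    have : 0 < r * (-(w 0 * cos φ + w 1 * sin φ)) := by linarith
    linarith [pos_of_mul_pos_right this hr0.le]
  have hl0 : 0 < l := by
    have hne : l ≠ 0 := by
      intro h0
      rw [h0, zero_mul] at e0 e1
      exact hv0 (plane_ext (by simpa using e0) (by simpa using e1))
    rw [e0, e1] at h2
    have h2' : l * (w 0 * cos φ + w 1 * sin φ) ≤ 0 := by linarith
    refine lt_of_le_of_ne ?_ hne.symm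
    by_contra! hneg
    linarith [mul_pos_of_neg_of_neg hneg hw]
  intro x hx
  have := hf x hx
  simp only [hfv, inner_plane, e0, e1] at this
  simp only [inner_plane, outwardNormal, Matrix.cons_val_zero,
    Matrix.cons_val_one]
  refine le_of_mul_le_mul_left ?_ hl0
  linarith

/-- The boundary of a smooth strictly convex domain can be parametrised smoothly by the angle of
the outward normal. -/
theorem exists_normal_angle_parametrization {K : Set Plane}
    (hK : IsSmoothStrictlyConvexDomain K) :
    ∃ (γ : ℝ → Plane) (ρ : ℝ → ℝ), ContDiff ℝ ∞ γ ∧ range γ = frontier K ∧ (∀ θ, 0 < ρ θ) ∧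
      (∀ θ, HasDerivAt γ (ρ θ • unitTangent θ) θ) ∧
      ∀ θ, ∀ x ∈ K, inner ℝ x (outwardNormal θ) ≤ inner ℝ (γ θ) (outwardNormal θ) := by
  obtain ⟨c, hc, hper, -, hreg, hcurv, hr⟩ := hK.smooth_boundary
  have hc1 := contDiff_infty_iff_deriv.1 hc
  have hc2 := contDiff_infty_iff_deriv.1 hc1.2
  have hco := contDiff_euclidean.1 hc1.2
  have hdd : ∀ t i, deriv (fun s => deriv c s i) t = deriv (deriv c) t i := by
    intro t i
    have := hasDerivAt_plane_iff.1 (hc2.1 t).hasDerivAt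
    fin_cases i
    · exact this.1.deriv
    · exact this.2.deriv
  have hnum : ∀ t, 0 < deriv c t 0 * deriv (deriv c) t 1 - deriv c t 1 * deriv (deriv c) t 0 := by
    intro t
    rw [curvature_mul_norm_cube (hreg t)]
    have := norm_pos_iff.2 (hreg t)
    have := hcurv t
    positivity
  have hden : ∀ t, 0 < deriv c t 0 ^ 2 + deriv c t 1 ^ 2 := by
    intro t
    rw [← norm_sq_plane]
    have := norm_pos_iff.2 (hreg t)
    positivity
  obtain ⟨r, φ₀, hφ₀, hr0, hx, hy, hφd⟩ := exists_smooth_angle (hco 0) (hco 1)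
    (fun t => (hden t).ne')
  simp only [hdd] at hφd
  set g : ℝ → ℝ := fun t => (deriv c t 0 * deriv (deriv c) t 1 -
    deriv c t 1 * deriv (deriv c) t 0) / (deriv c t 0 ^ 2 + deriv c t 1 ^ 2) with hg
  -- For a counterclockwise curve the outward normal is the tangent turned by `-π/2`.
  set φ : ℝ → ℝ := fun t => φ₀ t - π / 2 with hφ
  have hφc : ContDiff ℝ ∞ φ := hφ₀.sub contDiff_const
  have hφd' : ∀ t, HasDerivAt φ (g t) t := fun t => (hφd t).sub_const _
  have hgpos : ∀ t, 0 < g t := fun t => div_pos (hnum t) (hden t)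
  have hdper : Function.Periodic (deriv c) (2 * π) := fun t => by
    rw [← deriv_comp_add_const]; congr 1; exact funext hper
  have hddper : Function.Periodic (deriv (deriv c)) (2 * π) := fun t => by
    rw [← deriv_comp_add_const]; congr 1; exact funext hdper
  have hgper : Function.Periodic g (2 * π) := fun t => by
    simp only [hg, hdper t, hddper t]
  have hgc : Continuous g := by
    have := contDiff_infty_iff_deriv.1 hφc
    rw [← show deriv φ = g from funext fun t => (hφd' t).deriv]
    exact this.2.continuous
  -- Surjectivity onto all angles suffices: the turning number of `c` is never computed, since
  -- periodicity in `θ` is later inherited from the support function.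
  have hsurj := surjective_of_periodic_deriv_pos two_pi_pos hφd' hgc hgper hgpos
  obtain ⟨τ, hτ, hφτ, hτφ, hτd⟩ := exists_smooth_inverse hφc hφd' hgpos hsurj
  have htan : ∀ t, deriv c t = r t • unitTangent (φ t) := by
    intro t
    apply plane_ext
    · simp [unitTangent, hφ, sin_sub_pi_div_two, hx]
    · simp [unitTangent, hφ, cos_sub_pi_div_two, hy]
  refine ⟨c ∘ τ, fun θ => (g (τ θ))⁻¹ * r (τ θ), hc.comp hτ, ?_, fun θ => ?_, fun θ => ?_,
    fun θ => ?_⟩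
  · rw [(show Function.Surjective τ from fun t => ⟨φ t, hτφ t⟩).range_comp, hr]
  · have := hgpos (τ θ)
    have := hr0 (τ θ)
    positivity
  · have := HasDerivAt.scomp θ (hc1.1 (τ θ)).hasDerivAt (hτd θ)
    rwa [htan, hφτ, smul_smul] at this
  · have := inner_le_of_tangent_angle hK.strictConvex.convex hK.isCompact.isClosed
      hK.nonempty_interior hc hr (hr0 (τ θ)) (htan (τ θ)) (hnum _)
    rwa [hφτ] at this

/-- The standard facts on the support function and the boundary curve. -/
structure SupportData (K : Set Plane) : Prop where
  smooth : ContDiff ℝ ∞ (supportFunction K)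
  periodic : Function.Periodic (supportFunction K) (2 * π)
  radius_pos : ∀ θ, 0 < supportFunction K θ + deriv (deriv (supportFunction K)) θ
  range_eq : range (boundaryCurve K) = frontier K
  le_support : ∀ θ, ∀ x ∈ K, inner ℝ x (outwardNormal θ) ≤ supportFunction K θ
  inner_boundaryCurve : ∀ θ, inner ℝ (boundaryCurve K θ) (outwardNormal θ) = supportFunction K θ
  hasDerivAt_boundaryCurve : ∀ θ, HasDerivAt (boundaryCurve K)
    ((supportFunction K θ + deriv (deriv (supportFunction K)) θ) • unitTangent θ) θ

theorem IsSmoothStrictlyConvexDomain.supportData {K : Set Plane}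
    (hK : IsSmoothStrictlyConvexDomain K) : SupportData K := by
  obtain ⟨γ, ρ, hγ, hr, hρ, hd, hle⟩ := exists_normal_angle_parametrization hK
  have hmem : ∀ θ, γ θ ∈ K := fun θ =>
    hK.isCompact.isClosed.frontier_subset (hr ▸ mem_range_self θ)
  have hsup : supportFunction K = fun θ => inner ℝ (γ θ) (outwardNormal θ) := by
    ext θ
    refine IsGreatest.csSup_eq ⟨⟨γ θ, hmem θ, rfl⟩, ?_⟩
    rintro _ ⟨x, hx, rfl⟩
    exact hle θ x hx
  -- Envelope argument: `γ'` is orthogonal to the normal, so only the normal gets differentiated.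
  have hd1 : ∀ θ, HasDerivAt (supportFunction K) (inner ℝ (γ θ) (unitTangent θ)) θ := by
    intro θ
    rw [hsup]
    refine ((hd θ).inner ℝ (hasDerivAt_outwardNormal θ)).congr_deriv ?_
    simp only [inner_plane, unitTangent, outwardNormal, PiLp.smul_apply, 
     Matrix.cons_val_zero, Matrix.cons_val_one, smul_eq_mul]
    ring
  have hd1' : deriv (supportFunction K) = fun θ => inner ℝ (γ θ) (unitTangent θ) :=
    funext fun θ => (hd1 θ).deriv
  have hγeq : boundaryCurve K = γ := by
    ext1 θ
    have := sin_sq_add_cos_sq θ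
    apply plane_ext
    · simp only [boundaryCurve, hd1']
      simp only [hsup, inner_plane, unitTangent, outwardNormal, Matrix.cons_val_zero,
        Matrix.cons_val_one]
      linear_combination (γ θ 0) * this
    · simp only [boundaryCurve, hd1']
      simp only [hsup, inner_plane, unitTangent, outwardNormal, Matrix.cons_val_zero,
        Matrix.cons_val_one]
      linear_combination (γ θ 1) * this
  have hρeq : ∀ θ, supportFunction K θ + deriv (deriv (supportFunction K)) θ = ρ θ := by
    intro θ
    have h2 : HasDerivAt (deriv (supportFunction K))
        (ρ θ - inner ℝ (γ θ) (outwardNormal θ)) θ := by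
      rw [hd1']
      refine ((hd θ).inner ℝ (hasDerivAt_unitTangent θ)).congr_deriv ?_
      simp only [inner_plane, unitTangent, outwardNormal, PiLp.smul_apply, PiLp.neg_apply,
        Matrix.cons_val_zero, Matrix.cons_val_one, smul_eq_mul]
      linear_combination ρ θ * sin_sq_add_cos_sq θ
    rw [h2.deriv, hsup]
    ring
  refine ⟨?_, ?_, ?_, by rw [hγeq, hr], ?_, ?_, ?_⟩
  · rw [hsup]
    exact hγ.inner ℝ contDiff_outwardNormal
  · intro θ
    rw [supportFunction, outwardNormal_periodic θ, supportFunction]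
  · intro θ
    rw [hρeq]
    exact hρ θ
  · intro θ x hx
    rw [hsup]
    exact hle θ x hx
  · intro θ
    rw [hγeq, hsup]
  · intro θ
    rw [hγeq, hρeq]
    exact hd θ

/-! ### Curvature radii, length and evolute in terms of the support function -/

theorem norm_smul_outwardNormal (f θ : ℝ) : ‖f • outwardNormal θ‖ = |f| := by
  rw [norm_smul, norm_outwardNormal, mul_one, norm_eq_abs]

theorem norm_smul_unitTangent (f θ : ℝ) : ‖f • unitTangent θ‖ = |f| := by
  rw [norm_smul, norm_unitTangent, mul_one, norm_eq_abs]

/-- The frame rotates at unit speed, so the determinant of `c'` and `c''` is `f²`, whatever `f'` is.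
The quotient is left uncancelled so that `f θ = 0` is covered. -/
theorem curvature_of_deriv_eq_smul_unitTangent {c : ℝ → Plane} {f : ℝ → ℝ}
    (hc : ∀ θ, HasDerivAt c (f θ • unitTangent θ) θ) (hf : Differentiable ℝ f) (θ : ℝ) :
    curvature c θ = f θ ^ 2 / |f θ| ^ 3 := by
  have h1 : deriv c = fun θ => f θ • unitTangent θ := funext fun θ => (hc θ).deriv
  have h2 : deriv (deriv c) θ = f θ • (-outwardNormal θ) + deriv f θ • unitTangent θ := by
    rw [h1]
    exact ((hf θ).hasDerivAt.fun_smul (hasDerivAt_unitTangent θ)).deriv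
  rw [curvature, h2, h1, norm_smul_unitTangent]
  congr 1
  simp only [unitTangent, outwardNormal, PiLp.smul_apply, PiLp.add_apply, PiLp.neg_apply,
    Matrix.cons_val_zero, Matrix.cons_val_one, smul_eq_mul]
  linear_combination f θ ^ 2 * sin_sq_add_cos_sq θ

theorem curvature_of_deriv_eq_smul_outwardNormal {c : ℝ → Plane} {f : ℝ → ℝ}
    (hc : ∀ θ, HasDerivAt c (f θ • outwardNormal θ) θ) (hf : Differentiable ℝ f) (θ : ℝ) :
    curvature c θ = f θ ^ 2 / |f θ| ^ 3 := by
  have h1 : deriv c = fun θ => f θ • outwardNormal θ := funext fun θ => (hc θ).deriv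
  have h2 : deriv (deriv c) θ = f θ • unitTangent θ + deriv f θ • outwardNormal θ := by
    rw [h1]
    exact ((hf θ).hasDerivAt.fun_smul (hasDerivAt_outwardNormal θ)).deriv
  rw [curvature, h2, h1, norm_smul_outwardNormal]
  congr 1
  simp only [unitTangent, outwardNormal, PiLp.smul_apply, PiLp.add_apply,
    Matrix.cons_val_zero, Matrix.cons_val_one, smul_eq_mul]
  linear_combination f θ ^ 2 * sin_sq_add_cos_sq θ

namespace SupportData

variable {K : Set Plane} (S : SupportData K)
include S

theorem smooth_iterate (n : ℕ) : ContDiff ℝ ∞ (deriv^[n] (supportFunction K)) := by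
  induction n with
  | zero => exact S.smooth
  | succ n ih =>
    rw [Function.iterate_succ_apply']
    exact (contDiff_infty_iff_deriv.1 ih).2

theorem hasDerivAt_iterate (n : ℕ) (θ : ℝ) :
    HasDerivAt (deriv^[n] (supportFunction K)) (deriv^[n + 1] (supportFunction K) θ) θ := by
  rw [Function.iterate_succ_apply']
  exact ((contDiff_infty_iff_deriv.1 (S.smooth_iterate n)).1 θ).hasDerivAt

theorem continuous_iterate (n : ℕ) : Continuous (deriv^[n] (supportFunction K)) :=
  (S.smooth_iterate n).continuous

theorem periodic_iterate (n : ℕ) : Function.Periodic (deriv^[n] (supportFunction K)) (2 * π) := by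
  induction n with
  | zero => exact S.periodic
  | succ n ih =>
    intro θ
    rw [Function.iterate_succ_apply', ← deriv_comp_add_const]
    congr 1
    exact funext ih

theorem hasDerivAt_boundary (θ : ℝ) : HasDerivAt (boundaryCurve K)
    ((deriv^[0] (supportFunction K) θ + deriv^[2] (supportFunction K) θ) • unitTangent θ) θ :=
  S.hasDerivAt_boundaryCurve θ

theorem hasDerivAt_radius (θ : ℝ) :
    HasDerivAt (fun θ => deriv^[0] (supportFunction K) θ + deriv^[2] (supportFunction K) θ)
      (deriv^[1] (supportFunction K) θ + deriv^[3] (supportFunction K) θ) θ :=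
  (S.hasDerivAt_iterate 0 θ).fun_add (S.hasDerivAt_iterate 2 θ)

theorem radius_pos' (θ : ℝ) :
    0 < deriv^[0] (supportFunction K) θ + deriv^[2] (supportFunction K) θ :=
  S.radius_pos θ

theorem rho_eq (θ : ℝ) :
    rho K θ = deriv^[0] (supportFunction K) θ + deriv^[2] (supportFunction K) θ := by
  have hp := S.radius_pos' θ
  rw [rho, kappa, curvature_of_deriv_eq_smul_unitTangent S.hasDerivAt_boundary
    (fun θ => (S.hasDerivAt_radius θ).differentiableAt), abs_of_pos hp]
  field_simp

theorem rho_pos (θ : ℝ) : 0 < rho K θ := by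
  rw [S.rho_eq]; exact S.radius_pos' θ

theorem hasDerivAt_rho (θ : ℝ) : HasDerivAt (rho K)
    (deriv^[1] (supportFunction K) θ + deriv^[3] (supportFunction K) θ) θ := by
  rw [show rho K = _ from funext S.rho_eq]
  exact S.hasDerivAt_radius θ

theorem continuous_rho : Continuous (rho K) :=
  continuous_iff_continuousAt.2 fun θ => (S.hasDerivAt_rho θ).continuousAt

theorem periodic_rho : Function.Periodic (rho K) (2 * π) := fun θ => by
  rw [S.rho_eq, S.rho_eq, S.periodic_iterate 0 θ, S.periodic_iterate 2 θ]

/-- The tangential part `ρ T` of `γ'` cancels against the derivative of the normal in `-ρ N`. -/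
theorem hasDerivAt_evolute (θ : ℝ) : HasDerivAt (evolute K)
    ((-(deriv^[1] (supportFunction K) θ + deriv^[3] (supportFunction K) θ)) •
      outwardNormal θ) θ := by
  refine ((S.hasDerivAt_boundary θ).fun_add
    ((S.hasDerivAt_rho θ).fun_smul (hasDerivAt_outwardNormal θ).fun_neg)).congr_deriv ?_
  rw [S.rho_eq]
  module

theorem rhoBeta_sq (θ : ℝ) : rhoBeta K θ ^ 2 =
    (deriv^[1] (supportFunction K) θ + deriv^[3] (supportFunction K) θ) ^ 2 := by
  rw [rhoBeta, curvature_of_deriv_eq_smul_outwardNormal S.hasDerivAt_evolute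
    (fun θ => ((S.hasDerivAt_iterate 1 θ).fun_add
      (S.hasDerivAt_iterate 3 θ)).fun_neg.differentiableAt), sq_abs]
  set q := deriv^[1] (supportFunction K) θ + deriv^[3] (supportFunction K) θ
  -- At a cusp `q = 0` the curvature and its reciprocal are both `0` by the convention for division
  -- by zero.
  rcases eq_or_ne q 0 with h | h
  · simp [h]
  · have h' : |q| ≠ 0 := abs_ne_zero.2 h
    rw [abs_neg, neg_sq, ← sq_abs q]
    field_simp

theorem evolute_eq (θ : ℝ) : evolute K θ = deriv^[1] (supportFunction K) θ • unitTangent θ -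
    deriv^[2] (supportFunction K) θ • outwardNormal θ := by
  rw [evolute, S.rho_eq]
  apply plane_ext
  · simp [boundaryCurve, unitTangent, outwardNormal]; ring
  · simp [boundaryCurve, unitTangent, outwardNormal]; ring

theorem intervalIntegral_iterate_succ (n : ℕ) :
    ∫ θ in (0 : ℝ)..2 * π, deriv^[n + 1] (supportFunction K) θ = 0 := by
  rw [intervalIntegral.integral_eq_sub_of_hasDerivAt
    (fun θ _ => S.hasDerivAt_iterate n θ)
    ((S.continuous_iterate (n + 1)).intervalIntegrable _ _)]
  have := S.periodic_iterate n 0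
  rw [zero_add] at this
  rw [this, sub_self]

theorem perimeter_eq_integral_rho : perimeter K = ∫ θ in (0 : ℝ)..2 * π, rho K θ := by
  rw [perimeter, length]
  refine intervalIntegral.integral_congr fun θ _ => ?_
  simp only [(S.hasDerivAt_boundary θ).deriv, ← S.rho_eq, norm_smul_unitTangent,
    abs_of_pos (S.rho_pos θ)]

theorem perimeter_eq : perimeter K = ∫ θ in (0 : ℝ)..2 * π, deriv^[0] (supportFunction K) θ := by
  rw [S.perimeter_eq_integral_rho, show rho K = _ from funext S.rho_eq,
    intervalIntegral.integral_add ((S.continuous_iterate 0).intervalIntegrable _ _)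
      ((S.continuous_iterate 2).intervalIntegrable _ _), S.intervalIntegral_iterate_succ 1,
    add_zero]

theorem perimeter_pos : 0 < perimeter K := by
  rw [S.perimeter_eq_integral_rho]
  exact intervalIntegral.intervalIntegral_pos_of_pos (S.continuous_rho.intervalIntegrable _ _)
    S.rho_pos two_pi_pos

/-- Integration by parts over a period. -/
theorem integral_mul_iterate (m n : ℕ) :
    ∫ θ in (0 : ℝ)..2 * π, deriv^[m] (supportFunction K) θ * deriv^[n + 1] (supportFunction K) θ =
      -∫ θ in (0 : ℝ)..2 * π,
        deriv^[m + 1] (supportFunction K) θ * deriv^[n] (supportFunction K) θ := by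
  rw [intervalIntegral.integral_mul_deriv_eq_deriv_mul
    (fun θ _ => S.hasDerivAt_iterate m θ) (fun θ _ => S.hasDerivAt_iterate n θ)
    ((S.continuous_iterate (m + 1)).intervalIntegrable _ _)
    ((S.continuous_iterate (n + 1)).intervalIntegrable _ _)]
  have h1 := S.periodic_iterate m 0
  have h2 := S.periodic_iterate n 0
  rw [zero_add] at h1 h2
  rw [h1, h2, sub_self, zero_sub]

/-- Since `β = p' T - p'' N` and `β' = -(p' + p''') N`, the area integrand is `p' (p' + p''')`; the
mixed term is integrated by parts. -/
theorem evoluteArea_eq : evoluteArea K = 1 / 2 *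
    ∫ θ in (0 : ℝ)..2 * π, (deriv^[1] (supportFunction K) θ ^ 2 -
      deriv^[2] (supportFunction K) θ ^ 2) := by
  have h : ∀ θ, evolute K θ 0 * deriv (evolute K) θ 1 - evolute K θ 1 * deriv (evolute K) θ 0 =
      deriv^[1] (supportFunction K) θ ^ 2 +
        deriv^[1] (supportFunction K) θ * deriv^[3] (supportFunction K) θ := by
    intro θ
    rw [S.evolute_eq, (S.hasDerivAt_evolute θ).deriv]
    simp only [unitTangent, outwardNormal, PiLp.smul_apply, PiLp.sub_apply,
      Matrix.cons_val_zero, Matrix.cons_val_one, smul_eq_mul]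
    linear_combination deriv^[1] (supportFunction K) θ *
      (deriv^[1] (supportFunction K) θ + deriv^[3] (supportFunction K) θ) * sin_sq_add_cos_sq θ
  have c := S.continuous_iterate
  rw [evoluteArea, orientedArea]
  simp only [h]
  rw [intervalIntegral.integral_add (((c 1).fun_pow 2).intervalIntegrable _ _)
    (((c 1).fun_mul (c 3)).intervalIntegrable _ _), S.integral_mul_iterate 1 2,
    intervalIntegral.integral_sub (((c 1).fun_pow 2).intervalIntegrable _ _)
    (((c 2).fun_pow 2).intervalIntegrable _ _)]
  simp only [sq]
  ring

end SupportData

theorem intKappaSq_nonneg (K : Set Plane) : 0 ≤ intKappaSq K :=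
  intervalIntegral.integral_nonneg two_pi_pos.le fun θ _ => by positivity

/-! ### The area as an integral of support function times curvature radius -/

/-- The area swept by the segments from `(o₀, o₁)` to the points of a plane curve. -/
theorem volume_real_image_cone {a b a' b' : ℝ → ℝ} (o₀ o₁ : ℝ) (ha : ∀ θ, HasDerivAt a (a' θ) θ)
    (hb : ∀ θ, HasDerivAt b (b' θ) θ)
    (hpos : ∀ θ, 0 ≤ (a θ - o₀) * b' θ - (b θ - o₁) * a' θ)
    (hinj : InjOn (fun q : ℝ × ℝ => (o₀ + q.1 * (a q.2 - o₀), o₁ + q.1 * (b q.2 - o₁)))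
      (Ioo 0 1 ×ˢ Ico 0 (2 * π))) :
    volume.real ((fun q : ℝ × ℝ => (o₀ + q.1 * (a q.2 - o₀), o₁ + q.1 * (b q.2 - o₁))) ''
      (Ioo 0 1 ×ˢ Ico 0 (2 * π))) =
      1 / 2 * ∫ θ in (0 : ℝ)..2 * π, ((a θ - o₀) * b' θ - (b θ - o₁) * a' θ) := by
  set F : ℝ × ℝ → ℝ × ℝ := fun q => (o₀ + q.1 * (a q.2 - o₀), o₁ + q.1 * (b q.2 - o₁)) with hF
  set F' : ℝ × ℝ → ℝ × ℝ →L[ℝ] ℝ × ℝ := fun q =>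
    (Matrix.toLin (.finTwoProd ℝ) (.finTwoProd ℝ)
      !![a q.2 - o₀, q.1 * a' q.2; b q.2 - o₁, q.1 * b' q.2]).toContinuousLinearMap with hF'
  set S : Set (ℝ × ℝ) := Ioo 0 1 ×ˢ Ico 0 (2 * π) with hS
  have hcoord : ∀ (f f' : ℝ → ℝ) (o : ℝ) (q : ℝ × ℝ), (∀ θ, HasDerivAt f (f' θ) θ) →
      HasFDerivAt (fun q : ℝ × ℝ => o + q.1 * (f q.2 - o))
        ((f q.2 - o) • ContinuousLinearMap.fst ℝ ℝ ℝ +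
          (q.1 * f' q.2) • ContinuousLinearMap.snd ℝ ℝ ℝ) q := by
    intro f f' o q hf
    have h2 : HasFDerivAt (fun q : ℝ × ℝ => f q.2) (f' q.2 • ContinuousLinearMap.snd ℝ ℝ ℝ) q :=
      (hf q.2).comp_hasFDerivAt q (hasFDerivAt_snd (𝕜 := ℝ) (p := q))
    have h1 : HasFDerivAt (fun q : ℝ × ℝ => q.1) (ContinuousLinearMap.fst ℝ ℝ ℝ) q :=
      hasFDerivAt_fst
    refine ((h1.fun_mul (h2.sub_const o)).const_add o).congr_fderiv ?_
    ext <;> simp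
  have hFd : ∀ q, HasFDerivAt F (F' q) q := by
    intro q
    simp only [hF', Matrix.toLin_finTwoProd_toContinuousLinearMap]
    exact (hcoord a a' o₀ q ha).prodMk (hcoord b b' o₁ q hb)
  have hdet : ∀ q : ℝ × ℝ, (F' q).det =
      q.1 * ((a q.2 - o₀) * b' q.2 - (b q.2 - o₁) * a' q.2) := by
    intro q
    rw [hF']
    simp only [LinearMap.det_toContinuousLinearMap, LinearMap.det_toLin, Matrix.det_fin_two_of]
    ring
  have hSm : MeasurableSet S := measurableSet_Ioo.prod measurableSet_Ico
  -- The Jacobian is `s` times a function of `θ`, so the change of variables and Fubini split off `∫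
  -- s ds = 1/2`.
  have key := integral_image_eq_integral_abs_det_fderiv_smul volume hSm
    (fun q _ => (hFd q).hasFDerivWithinAt) hinj (fun _ => (1 : ℝ))
  rw [setIntegral_const, smul_eq_mul, mul_one] at key
  rw [key]
  have h1 : ∫ q in S, |(F' q).det| • (1 : ℝ) =
      ∫ q in S, q.1 * ((a q.2 - o₀) * b' q.2 - (b q.2 - o₁) * a' q.2) := by
    refine setIntegral_congr_fun hSm fun q hq => ?_
    have := hq.1.1
    simp only [smul_eq_mul, mul_one]
    rw [hdet, abs_of_nonneg (mul_nonneg this.le (hpos _))]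
  rw [h1, hS, Measure.volume_eq_prod, setIntegral_prod_mul (fun s : ℝ => s)
    (fun θ => (a θ - o₀) * b' θ - (b θ - o₁) * a' θ),
    ← integral_Ioc_eq_integral_Ioo, ← intervalIntegral.integral_of_le zero_le_one, integral_id,
    integral_Ico_eq_integral_Ioo, ← integral_Ioc_eq_integral_Ioo,
    ← intervalIntegral.integral_of_le two_pi_pos.le]
  norm_num

theorem volume_preserving_coordinates :
    MeasurePreserving (fun x : Plane => (x 0, x 1)) volume volume :=
  (volume_preserving_finTwoArrow ℝ).comp (PiLp.volume_preserving_ofLp (Fin 2))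

/-- A subset of the plane has the same area as its image in `ℝ × ℝ`. -/
theorem volume_real_image_coordinates (s : Set Plane) :
    volume.real ((fun x : Plane => (x 0, x 1)) '' s) = volume.real s := by
  let e : Plane ≃ᵐ ℝ × ℝ :=
    (MeasurableEquiv.toLp 2 (Fin 2 → ℝ)).symm.trans MeasurableEquiv.finTwoArrow
  have he : (fun x : Plane => (x 0, x 1)) = e := rfl
  have hm : MeasurePreserving e volume volume := he ▸ volume_preserving_coordinates
  rw [he, measureReal_def, measureReal_def, e.image_eq_preimage_symm, 
    (hm.symm e).measure_preimage_equiv]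

namespace SupportData

variable {K : Set Plane} (S : SupportData K)
include S

theorem inner_lt_of_mem_interior {o : Plane} (ho : o ∈ interior K) (θ : ℝ) :
    inner ℝ o (outwardNormal θ) < supportFunction K θ := by
  obtain ⟨ε, hε, hb⟩ := Metric.isOpen_iff.1 isOpen_interior o ho
  have hmem : o + (ε / 2) • outwardNormal θ ∈ K := by
    refine interior_subset (hb ?_)
    rw [Metric.mem_ball, dist_self_add_left, norm_smul_outwardNormal, abs_of_pos (by positivity)]
    linarith
  have := S.le_support θ _ hmem
  rw [inner_add_left, inner_smul_left, real_inner_self_eq_norm_sq, norm_outwardNormal] at this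
  simp only [conj_trivial] at this
  linarith

theorem periodic_boundaryCurve : Function.Periodic (boundaryCurve K) (2 * π) := fun θ => by
  have h0 := S.periodic_iterate 0 θ
  have h1 := S.periodic_iterate 1 θ
  simp only [Function.iterate_zero, id_eq, Function.iterate_one] at h0 h1
  simp only [boundaryCurve, h0, h1, cos_add_two_pi, sin_add_two_pi]

theorem boundaryCurve_mem (hcl : IsClosed K) (θ : ℝ) : boundaryCurve K θ ∈ K :=
  hcl.frontier_subset (S.range_eq ▸ mem_range_self θ)

/-- A common point of two parameters maximizes the functional of the second normal along the curve,
so the first tangent is orthogonal to that normal and the angles differ by a multiple of `π`.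
Opposite normals are impossible since `K` has interior. -/
theorem injOn_boundaryCurve (hcl : IsClosed K) (hint : (interior K).Nonempty) :
    InjOn (boundaryCurve K) (Ico 0 (2 * π)) := by
  intro θ hθ θ' hθ' h
  obtain ⟨o, ho⟩ := hint
  have hmax : IsLocalMax (fun s => inner ℝ (boundaryCurve K s) (outwardNormal θ')) θ :=
    Filter.Eventually.of_forall fun s => by
      simp only [h, S.inner_boundaryCurve]
      exact S.le_support _ _ (S.boundaryCurve_mem hcl s)
  have hd := HasDerivAt.inner_const_right (S.hasDerivAt_boundary θ) (outwardNormal θ')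
  have h0 := hmax.hasDerivAt_eq_zero hd
  rw [inner_smul_left, mul_eq_zero] at h0
  have h0 := h0.resolve_left (by simpa using (S.radius_pos' θ).ne')
  have hs : sin (θ' - θ) = 0 := by
    rw [sin_sub, ← h0]
    simp only [inner_plane, unitTangent, outwardNormal, Matrix.cons_val_zero, Matrix.cons_val_one]
    ring
  have hne : outwardNormal θ' ≠ -outwardNormal θ := by
    intro hneg
    have h1 := S.inner_lt_of_mem_interior ho θ
    have h2 := S.inner_lt_of_mem_interior ho θ'
    rw [← S.inner_boundaryCurve] at h1 h2
    rw [← h, hneg, inner_neg_right, inner_neg_right] at h2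
    linarith
  have hcos : cos (θ' - θ) ≠ -1 := by
    intro hc
    apply hne
    have h1 := cos_add θ (θ' - θ)
    have h2 := sin_add θ (θ' - θ)
    rw [hs, hc, add_sub_cancel] at h1 h2
    apply plane_ext
    · simpa [outwardNormal] using h1
    · simpa [outwardNormal] using h2
  obtain ⟨n, hn⟩ := sin_eq_zero_iff.1 hs
  have hn1 : (n : ℝ) < 2 := by
    have : (n : ℝ) * π < 2 * π := by linarith [hθ.1, hθ'.2]
    exact lt_of_mul_lt_mul_right this pi_pos.le
  have hn2 : (-2 : ℝ) < n := by
    have : (-2 : ℝ) * π < n * π := by linarith [hθ.2, hθ'.1]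
    exact lt_of_mul_lt_mul_right this pi_pos.le
  have hn1' : n < 2 := by exact_mod_cast hn1
  have hn2' : -2 < n := by exact_mod_cast hn2
  rw [← hn] at hcos
  interval_cases n
  · simp at hcos
  · simp at hn; linarith
  · simp at hcos

/-- Segments from an interior point `o` to the boundary sweep out the interior without `o`. The
gauge of `K - o` acts as radial coordinate, giving both injectivity and the exact image. -/
theorem area_eq (hconv : Convex ℝ K) (hcomp : IsCompact K) (hint : (interior K).Nonempty) :
    area K = 1 / 2 * ∫ θ in (0 : ℝ)..2 * π, supportFunction K θ * rho K θ := by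
  have hinjγ := S.injOn_boundaryCurve hcomp.isClosed hint
  obtain ⟨o, ho⟩ := hint
  set γ := boundaryCurve K with hγ
  set K₀ : Set Plane := (fun x => o + x) ⁻¹' K with hK₀
  have hconv₀ : Convex ℝ K₀ := hconv.translate_preimage_right o
  have hfr₀ : frontier K₀ = (fun x => o + x) ⁻¹' frontier K :=
    ((Homeomorph.addLeft o).preimage_frontier K).symm
  have hint₀ : interior K₀ = (fun x => o + x) ⁻¹' interior K :=
    ((Homeomorph.addLeft o).preimage_interior K).symm
  have hnhds : K₀ ∈ nhds (0 : Plane) := by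
    rw [mem_interior_iff_mem_nhds.symm, hint₀]
    simpa using ho
  have hbdd : Bornology.IsVonNBounded ℝ K₀ := by
    rw [NormedSpace.isVonNBounded_iff]
    exact ((Homeomorph.addLeft o).isCompact_preimage.2 hcomp).isBounded
  have hg1 : ∀ θ, gauge K₀ (γ θ - o) = 1 := by
    intro θ
    rw [gauge_eq_one_iff_mem_frontier hconv₀ hnhds, hfr₀, ← S.range_eq]
    simp [hγ]
  have hgs : ∀ s, 0 ≤ s → ∀ θ, gauge K₀ (s • (γ θ - o)) = s := by
    intro s hs θ
    rw [gauge_smul_of_nonneg hs, hg1, smul_eq_mul, mul_one]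
  have hinj : InjOn (fun q : ℝ × ℝ => o + q.1 • (γ q.2 - o)) (Ioo 0 1 ×ˢ Ico 0 (2 * π)) := by
    rintro ⟨s, θ⟩ ⟨hs, hθ⟩ ⟨s', θ'⟩ ⟨hs', hθ'⟩ h
    have h : s • (γ θ - o) = s' • (γ θ' - o) := add_left_cancel h
    have hss : s = s' := by
      rw [← hgs s hs.1.le θ, h, hgs s' hs'.1.le θ']
    subst hss
    have : γ θ - o = γ θ' - o := smul_right_injective _ hs.1.ne' h
    exact Prod.ext rfl (hinjγ hθ hθ' (sub_left_injective this))
  have himg : (fun q : ℝ × ℝ => o + q.1 • (γ q.2 - o)) '' (Ioo 0 1 ×ˢ Ico 0 (2 * π)) =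
      interior K \ {o} := by
    ext x
    have hx : x ∈ interior K ↔ gauge K₀ (x - o) < 1 := by
      rw [gauge_lt_one_iff_mem_interior hconv₀ hnhds, hint₀]
      simp
    constructor
    · rintro ⟨⟨s, θ⟩, ⟨hs, hθ⟩, rfl⟩
      have hg := hgs s hs.1.le θ
      refine ⟨by rw [hx, add_sub_cancel_left, hg]; exact hs.2, fun h => ?_⟩
      have h : s • (γ θ - o) = 0 := by simpa using h
      rw [h, gauge_zero] at hg
      exact hs.1.ne hg
    · rintro ⟨h1, h2⟩
      have hne : x - o ≠ 0 := sub_ne_zero.2 h2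
      have hpos : 0 < gauge K₀ (x - o) := (gauge_pos (absorbent_nhds_zero hnhds) hbdd).2 hne
      set s := gauge K₀ (x - o) with hs
      have hf : s⁻¹ • (x - o) ∈ frontier K₀ := by
        rw [← gauge_eq_one_iff_mem_frontier hconv₀ hnhds, gauge_smul_of_nonneg (by positivity),
          smul_eq_mul, ← hs, inv_mul_cancel₀ hpos.ne']
      rw [hfr₀, mem_preimage, ← S.range_eq] at hf
      obtain ⟨θ, hθ⟩ := hf
      obtain ⟨θ', hθ', he⟩ := S.periodic_boundaryCurve.exists_mem_Ico₀ two_pi_pos θ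
      refine ⟨(s, θ'), ⟨⟨hpos, hx.1 h1⟩, hθ'⟩, ?_⟩
      simp only [hγ]
      rw [← he, hθ, add_sub_cancel_left, smul_smul, mul_inv_cancel₀ hpos.ne', one_smul,
        add_sub_cancel]
  -- The boundary of a convex set is a null set.
  have hvol : area K = volume.real (interior K \ {o}) := by
    rw [area, measureReal_def, measureReal_def]
    congr 1
    refine le_antisymm ?_ (measure_mono (sdiff_subset.trans interior_subset))
    calc volume K ≤ volume ((interior K \ {o}) ∪ (frontier K ∪ {o})) := by
          refine measure_mono fun x hx => ?_
          by_cases h : x ∈ interior K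
          · by_cases hxo : x = o
            · exact Or.inr (Or.inr hxo)
            · exact Or.inl ⟨h, hxo⟩
          · exact Or.inr (Or.inl ⟨subset_closure hx, h⟩)
      _ ≤ volume (interior K \ {o}) + (volume (frontier K) + volume {o}) :=
          (measure_union_le _ _).trans (by gcongr; exact measure_union_le _ _)
      _ = volume (interior K \ {o}) := by
          rw [hconv.addHaar_frontier volume, measure_singleton, add_zero, add_zero]
  have hder := fun θ => hasDerivAt_plane_iff.1 (S.hasDerivAt_boundary θ)
  simp only [← S.rho_eq] at hder
  have hin : ∀ θ, (γ θ 0 - o 0) * (rho K θ • unitTangent θ) 1 -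
      (γ θ 1 - o 1) * (rho K θ • unitTangent θ) 0 =
      (supportFunction K θ - inner ℝ o (outwardNormal θ)) * rho K θ := by
    intro θ
    rw [← S.inner_boundaryCurve]
    simp only [inner_plane, unitTangent, outwardNormal, PiLp.smul_apply, Matrix.cons_val_zero,
      Matrix.cons_val_one, smul_eq_mul]
    ring
  have hcomp : (fun x : Plane => (x 0, x 1)) ∘ (fun q : ℝ × ℝ => o + q.1 • (γ q.2 - o)) =
      fun q : ℝ × ℝ => (o 0 + q.1 * (γ q.2 0 - o 0), o 1 + q.1 * (γ q.2 1 - o 1)) := by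
    ext q <;> simp
  have hcoord_inj : Function.Injective (fun x : Plane => (x 0, x 1)) := fun x y h =>
    plane_ext (congrArg Prod.fst h) (congrArg Prod.snd h)
  have key := volume_real_image_cone (o 0) (o 1) (fun θ => (hder θ).1) (fun θ => (hder θ).2)
    (fun θ => by
      rw [hin]
      exact mul_nonneg (sub_nonneg.2 (S.inner_lt_of_mem_interior ho θ).le) (S.rho_pos θ).le)
    (by rw [← hcomp]; exact hcoord_inj.comp_injOn hinj)
  rw [← hcomp, image_comp, volume_real_image_coordinates, himg, ← hvol] at key
  rw [key]
  congr 1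
  have hA : Continuous fun θ => supportFunction K θ * rho K θ :=
    (S.continuous_iterate 0).fun_mul S.continuous_rho
  have hB : Continuous fun θ => inner ℝ o (outwardNormal θ) * rho K θ :=
    (continuous_const.inner contDiff_outwardNormal.continuous).fun_mul S.continuous_rho
  -- The dependence on `o` drops out: it is the integral of an exact derivative along a closed
  -- curve.
  have hzero : ∫ θ in (0 : ℝ)..2 * π, inner ℝ o (outwardNormal θ) * rho K θ = 0 := by
    rw [intervalIntegral.integral_eq_sub_of_hasDerivAt
      (f := fun θ => o 0 * γ θ 1 - o 1 * γ θ 0) (fun θ _ => ?_) (hB.intervalIntegrable _ _)]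
    · have := S.periodic_boundaryCurve 0
      rw [zero_add] at this
      simp only [hγ, this, sub_self]
    · refine (((hder θ).2.const_mul (o 0)).fun_sub ((hder θ).1.const_mul (o 1))).congr_deriv ?_
      simp only [inner_plane, unitTangent, outwardNormal, PiLp.smul_apply, Matrix.cons_val_zero,
        Matrix.cons_val_one, smul_eq_mul]
      ring
  have hsub := intervalIntegral.integral_sub (μ := volume)
    (hA.intervalIntegrable 0 (2 * π)) (hB.intervalIntegrable 0 (2 * π))
  rw [hzero, sub_zero] at hsub
  rw [← hsub]
  refine intervalIntegral.integral_congr fun θ _ => ?_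
  exact (hin θ).trans (sub_mul _ _ _)

end SupportData

/-! ### Fourier series and the oscillation estimate -/

theorem fourierCoeffOn_of_periodic_deriv {f f' : ℝ → ℂ} (hd : ∀ x, HasDerivAt f (f' x) x)
    (hc : Continuous f') (hper : f (2 * π) = f 0) (n : ℤ) :
    fourierCoeffOn two_pi_pos f' n = Complex.I * n * fourierCoeffOn two_pi_pos f n := by
  rcases eq_or_ne n 0 with rfl | hn
  · rw [fourierCoeffOn_eq_integral]
    simp only [neg_zero, fourier_zero, one_smul]
    rw [intervalIntegral.integral_eq_sub_of_hasDerivAt (fun x _ => hd x)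
      (hc.intervalIntegrable _ _), hper]
    simp
  · rw [fourierCoeffOn_of_hasDerivAt two_pi_pos hn (fun x _ => hd x) (hc.intervalIntegrable _ _),
      hper]
    have hn' : (n : ℂ) ≠ 0 := Int.cast_ne_zero.2 hn
    have hπ : (π : ℂ) ≠ 0 := Complex.ofReal_ne_zero.2 pi_ne_zero
    push_cast
    field_simp
    simp
    ring

theorem hasSum_norm_sq_fourierCoeffOn_real {f : ℝ → ℝ} (hf : Continuous f) :
    HasSum (fun n : ℤ => ‖fourierCoeffOn two_pi_pos (fun x => (f x : ℂ)) n‖ ^ 2)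
      ((2 * π)⁻¹ * ∫ x in (0 : ℝ)..2 * π, f x ^ 2) := by
  have hc : Continuous fun x => (f x : ℂ) := Complex.continuous_ofReal.comp hf
  have hm : MemLp (fun x => (f x : ℂ)) 2 (volume.restrict (Ioc 0 (2 * π))) := by
    obtain ⟨C, hC⟩ := isCompact_Icc.exists_bound_of_continuousOn
      (s := Icc 0 (2 * π)) hc.continuousOn
    refine MemLp.of_bound hc.aestronglyMeasurable C ?_
    refine (ae_restrict_iff' measurableSet_Ioc).2 (Filter.Eventually.of_forall fun x hx => ?_)
    exact hC x ⟨hx.1.le, hx.2⟩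
  simpa using hasSum_sq_fourierCoeffOn two_pi_pos hm

/-- The Fourier series of a continuous periodic function with summable coefficients converges
pointwise. -/
theorem hasSum_fourierCoeffOn_real {f : ℝ → ℝ} (hf : Continuous f)
    (hper : Function.Periodic f (2 * π))
    (hs : Summable fun n : ℤ => ‖fourierCoeffOn two_pi_pos (fun x => (f x : ℂ)) n‖) (x : ℝ) :
    HasSum (fun n : ℤ => fourierCoeffOn two_pi_pos (fun x => (f x : ℂ)) n *
      Complex.exp (n * x * Complex.I)) (f x : ℂ) := by
  have : Fact (0 < 2 * π) := ⟨two_pi_pos⟩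
  have hperC : Function.Periodic (fun x => (f x : ℂ)) (2 * π) := fun x => by simp [hper x]
  let F : C(AddCircle (2 * π), ℂ) := ⟨hperC.lift,
    continuous_coinduced_dom.2 (Complex.continuous_ofReal.comp hf)⟩
  have hFx : ∀ x : ℝ, F x = f x := fun x => hperC.lift_coe x
  have hcoeff : ∀ n, fourierCoeff F n = fourierCoeffOn two_pi_pos (fun x => (f x : ℂ)) n := by
    intro n
    rw [fourierCoeff_eq_intervalIntegral _ n 0, fourierCoeffOn_eq_integral]
    simp only [zero_add, sub_zero, hFx, fourier_coe_apply]
  have hsum : Summable (fourierCoeff F) := by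
    refine Summable.of_norm ?_
    simpa only [hcoeff] using hs
  have := has_pointwise_sum_fourier_series_of_summable hsum (x : AddCircle (2 * π))
  rw [hFx] at this
  convert this using 2 with n
  rw [hcoeff, smul_eq_mul, fourier_coe_apply]
  congr 2
  have hπ : (π : ℂ) ≠ 0 := Complex.ofReal_ne_zero.2 pi_ne_zero
  push_cast
  field_simp

/-- Twice `ζ(4) = π⁴/90`; the term `n = 0` is `1 / 0 = 0`. -/
theorem hasSum_int_inv_pow_four : HasSum (fun n : ℤ => 1 / (n : ℝ) ^ 4) (π ^ 4 / 45) := by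
  have h1 := hasSum_zeta_four
  have h2 : HasSum (fun n : ℕ => 1 / ((n + 1 : ℕ) : ℝ) ^ 4) (π ^ 4 / 90) := by
    rw [hasSum_nat_add_iff 1 (f := fun n : ℕ => 1 / (n : ℝ) ^ 4)]
    simpa using h1
  have h := HasSum.of_nat_of_neg_add_one (f := fun n : ℤ => 1 / (n : ℝ) ^ 4)
    (by simpa using h1) (h2.congr_fun (fun n => ?_))
  · convert h using 1
    ring
  · push_cast
    rw [neg_pow]
    norm_num

theorem hasSum_int_inv_pow_four_of_two_le :
    HasSum (fun n : ℤ => if n ∈ ({-1, 0, 1} : Finset ℤ) then 0 else 1 / (n : ℝ) ^ 4)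
      (π ^ 4 / 45 - 2) := by
  have h := hasSum_int_inv_pow_four.sub (hasSum_sum_of_ne_finset_zero
    (s := ({-1, 0, 1} : Finset ℤ))
    (f := fun n : ℤ => if n ∈ ({-1, 0, 1} : Finset ℤ) then 1 / (n : ℝ) ^ 4 else 0)
    (fun n hn => if_neg hn))
  have e : (fun n : ℤ => if n ∈ ({-1, 0, 1} : Finset ℤ) then 0 else 1 / (n : ℝ) ^ 4) =
      fun n : ℤ => 1 / (n : ℝ) ^ 4 -
        if n ∈ ({-1, 0, 1} : Finset ℤ) then 1 / (n : ℝ) ^ 4 else 0 := by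
    ext n
    split_ifs <;> simp
  have e' : ∑ n ∈ ({-1, 0, 1} : Finset ℤ),
      (if n ∈ ({-1, 0, 1} : Finset ℤ) then 1 / (n : ℝ) ^ 4 else 0) = 2 := by
    rw [Finset.sum_ite_mem, Finset.inter_self]
    norm_num [Finset.sum_insert]
  rwa [e, ← e']

/-- With `97.5 = 45 · 13/6` the tail `π⁴/45 - 2` is below `1/6`, which is sharp enough for the
factor `9/10` in `sq_hasSum_le`. -/
theorem pi_pow_four_lt : π ^ 4 < 97.5 := by
  have h := pi_lt_d4
  have h2 : π ^ 2 < 9.87 := by nlinarith [pi_pos]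
  nlinarith [sq_nonneg π]

/-- A function of mean value zero without first harmonics oscillates by at most
`√(0.9 ∑ n²(n²-1)|c_n|²)`. -/
theorem sq_hasSum_le {c : ℤ → ℂ} {E : ℝ}
    (hE : HasSum (fun n : ℤ => ((n : ℝ) ^ 4 - (n : ℝ) ^ 2) * ‖c n‖ ^ 2) E) {g : ℤ → ℝ} {D : ℝ}
    (hg : ∀ n, |g n| ≤ 2 * ‖c n‖)
    (hD : HasSum (fun n : ℤ => if n ∈ ({-1, 0, 1} : Finset ℤ) then 0 else g n) D) (hD0 : 0 ≤ D) :
    D ^ 2 ≤ 9 / 10 * E := by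
  have hE0 : 0 ≤ E := hE.nonneg fun n => by
    have : (0 : ℝ) ≤ (n : ℝ) ^ 4 - (n : ℝ) ^ 2 := by
      have h : (0 : ℤ) ≤ n ^ 4 - n ^ 2 := by
        rcases eq_or_ne n 0 with rfl | h
        · simp
        · have : 0 < n ^ 2 := by positivity
          nlinarith
      exact_mod_cast h
    positivity
  rcases hD0.eq_or_lt with rfl | hpos
  · simpa using by positivity
  -- The factor `4/3` comes from `n⁴ - n² ≥ (3/4) n⁴` for `|n| ≥ 2`.
  set k : ℝ := 4 / 3 * (π ^ 4 / 45 - 2) with hk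
  have hk1 : k < 9 / 40 := by have := pi_pow_four_lt; rw [hk]; norm_num at this ⊢; linarith
  -- The weight for the termwise inequality `2ab ≤ a² + b²`: as `k < 9/40`, this choice makes `l⁻¹ k
  -- ≤ D/2`, which is absorbed on the left.
  set l : ℝ := 9 / 20 / D with hl
  have hlpos : 0 < l := by positivity
  have hmain : D ≤ l * E + l⁻¹ * (4 / 3) * (π ^ 4 / 45 - 2) := by
    refine hasSum_le (fun n => ?_) hD
      ((hE.mul_left l).add (hasSum_int_inv_pow_four_of_two_le.mul_left (l⁻¹ * (4 / 3))))
    by_cases hn : n ∈ ({-1, 0, 1} : Finset ℤ)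
    · simp only [if_pos hn]
      simp only [Finset.mem_insert, Finset.mem_singleton] at hn
      rcases hn with rfl | rfl | rfl <;> norm_num
    · simp only [if_neg hn]
      simp only [Finset.mem_insert, Finset.mem_singleton, not_or] at hn
      have h4 : (4 : ℤ) ≤ n ^ 2 := by
        rcases le_or_gt n 0 with h | h
        · have : n ≤ -2 := by omega
          nlinarith
        · have : 2 ≤ n := by omega
          nlinarith
      have h4 : (4 : ℝ) ≤ (n : ℝ) ^ 2 := by exact_mod_cast h4
      set m : ℝ := (n : ℝ) ^ 2 with hm
      have e4 : (n : ℝ) ^ 4 = m ^ 2 := by rw [hm]; ring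
      rw [e4]
      have hw : 3 / 4 * m ^ 2 ≤ m ^ 2 - m := by nlinarith
      have hx := norm_nonneg (c n)
      set x := ‖c n‖
      calc g n ≤ 2 * x := (le_abs_self _).trans (hg n)
        _ ≤ l * (3 / 4 * m ^ 2 * x ^ 2) + l⁻¹ * (4 / 3) * (1 / m ^ 2) := by
          have hmp : 0 < m := by linarith
          have : l * (3 / 4 * m ^ 2 * x ^ 2) + l⁻¹ * (4 / 3) * (1 / m ^ 2) - 2 * x =
              l * (3 / 4) * (m * x - (4 / 3) * l⁻¹ / m) ^ 2 := by
            field_simp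
            ring
          have h0 : 0 ≤ l * (3 / 4) * (m * x - (4 / 3) * l⁻¹ / m) ^ 2 := by positivity
          linarith
        _ ≤ l * ((m ^ 2 - m) * x ^ 2) + l⁻¹ * (4 / 3) * (1 / m ^ 2) := by gcongr
  have hmain' : D ≤ l * E + l⁻¹ * k := by rw [hk, ← mul_assoc]; exact hmain
  have hlinv : l⁻¹ = D / (9 / 20) := by rw [hl, inv_div]
  have h3 : l⁻¹ * k ≤ D / 2 := by
    rw [hlinv]
    have : D / (9 / 20) * k ≤ D / (9 / 20) * (9 / 40) := by gcongr
    linarith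
  have h4 : D / 2 ≤ 9 / 20 / D * E := by rw [← hl]; linarith
  rw [div_mul_eq_mul_div, le_div_iff₀ hpos] at h4
  nlinarith

/-! ### The geometric functionals as quadratic forms in the Fourier coefficients -/

/-- The Fourier coefficients of the support function. -/
def supportCoeff (K : Set Plane) (n : ℤ) : ℂ :=
  fourierCoeffOn two_pi_pos (fun θ => (supportFunction K θ : ℂ)) n

/-- The mean square of the `k`-th derivative of the support function. -/
def meanSq (K : Set Plane) (k : ℕ) : ℝ :=
  (2 * π)⁻¹ * ∫ θ in (0 : ℝ)..2 * π, deriv^[k] (supportFunction K) θ ^ 2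

/-- The spectral gap: the polynomials behind (b) and (c) take negative values between `1` and `4`,
where no `n²` lies. -/
theorem int_sq_eq_one_or_four_le {n : ℤ} (hn : n ≠ 0) : (n : ℝ) ^ 2 = 1 ∨ 4 ≤ (n : ℝ) ^ 2 := by
  have h : n ^ 2 = 1 ∨ 4 ≤ n ^ 2 := by
    rcases lt_or_gt_of_ne hn with h | h
    · rcases eq_or_lt_of_le (show n ≤ -1 by omega) with rfl | h
      · simp
      · exact Or.inr (by nlinarith)
    · rcases eq_or_lt_of_le (show 1 ≤ n by omega) with rfl | h
      · simp
      · exact Or.inr (by nlinarith)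
  exact_mod_cast h

theorem integral_sq_eq (K : Set Plane) (k : ℕ) :
    ∫ θ in (0 : ℝ)..2 * π, deriv^[k] (supportFunction K) θ ^ 2 = 2 * π * meanSq K k := by
  rw [meanSq, mul_inv_cancel_left₀ two_pi_pos.ne']

theorem intRhoBetaSq_nonneg (K : Set Plane) : 0 ≤ intRhoBetaSq K :=
  intervalIntegral.integral_nonneg two_pi_pos.le fun θ _ => by positivity

namespace SupportData

variable {K : Set Plane} (S : SupportData K)
include S

theorem fourierCoeffOn_iterate (k : ℕ) (n : ℤ) :
    fourierCoeffOn two_pi_pos (fun θ => ((deriv^[k] (supportFunction K) θ : ℝ) : ℂ)) n =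
      (Complex.I * n) ^ k * supportCoeff K n := by
  induction k with
  | zero => simp [supportCoeff]
  | succ k ih =>
    have hp := S.periodic_iterate k 0
    rw [zero_add] at hp
    rw [fourierCoeffOn_of_periodic_deriv (fun θ => (S.hasDerivAt_iterate k θ).ofReal_comp)
      (Complex.continuous_ofReal.comp (S.continuous_iterate (k + 1))) (by rw [hp]), ih]
    ring

theorem hasSum_meanSq (k : ℕ) :
    HasSum (fun n : ℤ => ((n : ℝ) ^ 2) ^ k * ‖supportCoeff K n‖ ^ 2) (meanSq K k) := by
  have h := hasSum_norm_sq_fourierCoeffOn_real (S.continuous_iterate k)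
  simp only [S.fourierCoeffOn_iterate] at h
  rw [← meanSq] at h
  convert h using 2 with n
  rw [norm_mul, norm_pow, norm_mul, Complex.norm_I, one_mul, Complex.norm_intCast, mul_pow,
    pow_right_comm |(n : ℝ)|, sq_abs]

/-- Termwise comparison of quadratic forms in the Fourier coefficients. -/
theorem coeff_zero_le_meanSq {a₀ a₁ a₂ a₃ : ℝ} (h : ∀ m : ℝ, m = 1 ∨ 4 ≤ m →
    0 ≤ a₀ + a₁ * m + a₂ * m ^ 2 + a₃ * m ^ 3) :
    a₀ * ‖supportCoeff K 0‖ ^ 2 ≤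
      a₀ * meanSq K 0 + a₁ * meanSq K 1 + a₂ * meanSq K 2 + a₃ * meanSq K 3 := by
  have hs := ((((S.hasSum_meanSq 0).mul_left a₀).add ((S.hasSum_meanSq 1).mul_left a₁)).add
    ((S.hasSum_meanSq 2).mul_left a₂)).add ((S.hasSum_meanSq 3).mul_left a₃)
  -- The left side is a series supported at `n = 0`, where the two terms agree; hence `h` need not
  -- cover `m = 0`.
  refine hasSum_le (fun n => ?_) (hasSum_ite_eq 0 (a₀ * ‖supportCoeff K 0‖ ^ 2)) hs
  rcases eq_or_ne n 0 with rfl | hn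
  · simp
  · rw [if_neg hn]
    have := mul_nonneg (h _ (int_sq_eq_one_or_four_le hn)) (sq_nonneg ‖supportCoeff K n‖)
    linarith

theorem supportCoeff_zero : supportCoeff K 0 = ((2 * π)⁻¹ * perimeter K : ℝ) := by
  rw [supportCoeff, fourierCoeffOn_eq_integral, S.perimeter_eq]
  simp only [neg_zero, fourier_zero, one_smul, sub_zero, Function.iterate_zero, id_eq, one_div,
    intervalIntegral.integral_ofReal, Complex.real_smul]
  push_cast
  rfl

theorem perimeter_sq : perimeter K ^ 2 = 4 * π ^ 2 * ‖supportCoeff K 0‖ ^ 2 := by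
  rw [S.supportCoeff_zero, Complex.norm_real, norm_eq_abs, sq_abs]
  have := pi_pos
  field_simp
  ring

theorem integral_sq_add (k : ℕ) :
    ∫ θ in (0 : ℝ)..2 * π, (deriv^[k] (supportFunction K) θ +
      deriv^[k + 2] (supportFunction K) θ) ^ 2 =
      2 * π * (meanSq K k - 2 * meanSq K (k + 1) + meanSq K (k + 2)) := by
  have c := S.continuous_iterate
  have e : ∀ θ, (deriv^[k] (supportFunction K) θ + deriv^[k + 2] (supportFunction K) θ) ^ 2 =
      deriv^[k] (supportFunction K) θ ^ 2 +
        2 * (deriv^[k] (supportFunction K) θ * deriv^[k + 2] (supportFunction K) θ) +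
        deriv^[k + 2] (supportFunction K) θ ^ 2 := fun θ => by ring
  simp only [e]
  have i₁ := ((c k).fun_pow 2).intervalIntegrable (μ := volume) 0 (2 * π)
  have c₂ : Continuous fun θ =>
      2 * (deriv^[k] (supportFunction K) θ * deriv^[k + 2] (supportFunction K) θ) :=
    continuous_const.fun_mul ((c k).fun_mul (c (k + 2)))
  have i₂ := c₂.intervalIntegrable (μ := volume) 0 (2 * π)
  have i₃ := ((c (k + 2)).fun_pow 2).intervalIntegrable (μ := volume) 0 (2 * π)
  rw [intervalIntegral.integral_add (i₁.add i₂) i₃, intervalIntegral.integral_add i₁ i₂,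
    intervalIntegral.integral_const_mul, S.integral_mul_iterate k (k + 1)]
  simp only [← sq]
  rw [integral_sq_eq, integral_sq_eq, integral_sq_eq]
  ring

theorem intRhoSq_eq : intRhoSq K = 2 * π * (meanSq K 0 - 2 * meanSq K 1 + meanSq K 2) := by
  rw [← S.integral_sq_add 0, intRhoSq]
  simp only [S.rho_eq]

theorem intRhoBetaSq_eq :
    intRhoBetaSq K = 2 * π * (meanSq K 1 - 2 * meanSq K 2 + meanSq K 3) := by
  rw [← S.integral_sq_add 1, intRhoBetaSq]
  simp only [S.rhoBeta_sq]

/-- Wirtinger's inequality for `p'`; it fixes the sign of the evolute area as nonpositive. -/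
theorem meanSq_one_le_two : meanSq K 1 ≤ meanSq K 2 := by
  have := S.coeff_zero_le_meanSq (a₀ := 0) (a₁ := -1) (a₂ := 1) (a₃ := 0)
    (by rintro m (rfl | h) <;> nlinarith)
  linarith

theorem abs_evoluteArea_eq : |evoluteArea K| = π * (meanSq K 2 - meanSq K 1) := by
  have c := S.continuous_iterate
  rw [S.evoluteArea_eq, intervalIntegral.integral_sub (((c 1).fun_pow 2).intervalIntegrable _ _)
    (((c 2).fun_pow 2).intervalIntegrable _ _), integral_sq_eq, integral_sq_eq,
    abs_of_nonpos]
  · ring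
  · nlinarith [S.meanSq_one_le_two, pi_pos]

theorem area_eq_meanSq (hconv : Convex ℝ K) (hcomp : IsCompact K) (hint : (interior K).Nonempty) :
    area K = π * (meanSq K 0 - meanSq K 1) := by
  have c := S.continuous_iterate
  have e : ∀ θ, supportFunction K θ * rho K θ = deriv^[0] (supportFunction K) θ ^ 2 +
      deriv^[0] (supportFunction K) θ * deriv^[2] (supportFunction K) θ := fun θ => by
    rw [S.rho_eq, Function.iterate_zero, id_eq]; ring
  rw [S.area_eq hconv hcomp hint]
  simp only [e]
  rw [intervalIntegral.integral_add (((c 0).fun_pow 2).intervalIntegrable _ _)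
    (((c 0).fun_mul (c 2)).intervalIntegrable _ _), S.integral_mul_iterate 0 1]
  simp only [← sq]
  rw [integral_sq_eq, integral_sq_eq]
  ring

/-- Apply `ab ≤ (a² + b²)/2` to `n² |c_n|` and `n⁻²`. -/
theorem summable_norm_supportCoeff : Summable fun n : ℤ => ‖supportCoeff K n‖ := by
  refine Summable.of_nonneg_of_le (fun n => norm_nonneg _) (fun n => ?_)
    ((((S.hasSum_meanSq 2).summable.add hasSum_int_inv_pow_four.summable).mul_left (1 / 2)).add
      (hasSum_ite_eq (0 : ℤ) ‖supportCoeff K 0‖).summable)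
  rcases eq_or_ne n 0 with rfl | hn
  · simp
  · simp only [if_neg hn, add_zero]
    have hn' : (n : ℝ) ≠ 0 := Int.cast_ne_zero.2 hn
    have : 1 / 2 * (((n : ℝ) ^ 2) ^ 2 * ‖supportCoeff K n‖ ^ 2 + 1 / (n : ℝ) ^ 4) -
        ‖supportCoeff K n‖ = 1 / 2 * ((n : ℝ) ^ 2 * ‖supportCoeff K n‖ - 1 / (n : ℝ) ^ 2) ^ 2 := by
      field_simp
      ring
    nlinarith [sq_nonneg ((n : ℝ) ^ 2 * ‖supportCoeff K n‖ - 1 / (n : ℝ) ^ 2)]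

theorem hasSum_supportFunction (θ : ℝ) :
    HasSum (fun n : ℤ => (supportCoeff K n * Complex.exp (n * θ * Complex.I)).re)
      (supportFunction K θ) := by
  have := hasSum_fourierCoeffOn_real (S.continuous_iterate 0) S.periodic
    S.summable_norm_supportCoeff θ
  exact Complex.hasSum_re this

/-- With respect to a suitable origin, the oscillation of the support function is controlled by
the area enclosed by the evolute. -/
theorem exists_center_sq_sub_le : ∃ z : Plane, ∀ s t,
    (supportFunction K s - inner ℝ z (outwardNormal s)) -
      (supportFunction K t - inner ℝ z (outwardNormal t)) ≥ 0 →
    ((supportFunction K s - inner ℝ z (outwardNormal s)) -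
      (supportFunction K t - inner ℝ z (outwardNormal t))) ^ 2 ≤
        9 / 10 * (meanSq K 2 - meanSq K 1) := by
  set C := supportCoeff K with hC
  set u : ℤ → ℝ → ℝ := fun n θ => (C n * Complex.exp (n * θ * Complex.I)).re with hu
  -- This point (the Steiner point of `K`) is the one whose support function equals the first
  -- harmonics of `p`; the harmonic `n = 0` cancels in the difference.
  refine ⟨!₂[(C 1).re + (C (-1)).re, -(C 1).im + (C (-1)).im], fun s t hst => ?_⟩
  have hz : ∀ θ, inner ℝ (!₂[(C 1).re + (C (-1)).re, -(C 1).im + (C (-1)).im] : Plane)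
      (outwardNormal θ) = u 1 θ + u (-1) θ := by
    intro θ
    have e1 : Complex.exp (θ * Complex.I) = ⟨cos θ, sin θ⟩ := by
      rw [Complex.exp_mul_I, ← Complex.ofReal_cos, ← Complex.ofReal_sin, Complex.mk_eq_add_mul_I]
    have e2 : Complex.exp (-θ * Complex.I) = ⟨cos θ, -sin θ⟩ := by
      rw [Complex.exp_mul_I, Complex.cos_neg, Complex.sin_neg, ← Complex.ofReal_cos,
        ← Complex.ofReal_sin, Complex.mk_eq_add_mul_I]
      push_cast
      ring
    simp only [hu, Int.cast_one, one_mul, Int.cast_neg, neg_mul, inner_plane, outwardNormal,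
      Matrix.cons_val_zero, Matrix.cons_val_one]
    rw [← neg_mul, e1, e2]
    simp only [Complex.mul_re]
    ring
  refine sq_hasSum_le (c := C) (g := fun n => u n s - u n t) ?_ (fun n => ?_) ?_ hst
  · have e : (fun n : ℤ => ((n : ℝ) ^ 4 - (n : ℝ) ^ 2) * ‖C n‖ ^ 2) = fun n : ℤ =>
        ((n : ℝ) ^ 2) ^ 2 * ‖C n‖ ^ 2 - ((n : ℝ) ^ 2) ^ 1 * ‖C n‖ ^ 2 := funext fun n => by ring
    rw [e]
    exact (S.hasSum_meanSq 2).sub (S.hasSum_meanSq 1)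
  · have hb : ∀ θ, |u n θ| ≤ ‖C n‖ := by
      intro θ
      refine (Complex.abs_re_le_norm _).trans ?_
      rw [norm_mul, show (n * θ * Complex.I : ℂ) = ((n * θ : ℝ) : ℂ) * Complex.I by push_cast; ring,
        Complex.norm_exp_ofReal_mul_I, mul_one]
    calc |u n s - u n t| ≤ |u n s| + |u n t| := abs_sub _ _
      _ ≤ 2 * ‖C n‖ := by linarith [hb s, hb t]
  · have h := ((S.hasSum_supportFunction s).sub (S.hasSum_supportFunction t)).sub
      (hasSum_sum_of_ne_finset_zero (s := ({-1, 0, 1} : Finset ℤ))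
        (f := fun n : ℤ => if n ∈ ({-1, 0, 1} : Finset ℤ) then u n s - u n t else 0)
        (fun n hn => if_neg hn))
    have e : (fun n : ℤ => if n ∈ ({-1, 0, 1} : Finset ℤ) then 0 else u n s - u n t) =
        fun n : ℤ => (C n * Complex.exp (n * s * Complex.I)).re -
          (C n * Complex.exp (n * t * Complex.I)).re -
          if n ∈ ({-1, 0, 1} : Finset ℤ) then u n s - u n t else 0 := by
      ext n
      split_ifs <;> simp [hu]
    have h0 : u 0 s = u 0 t := by simp [hu]
    rw [Finset.sum_ite_mem, Finset.inter_self, Finset.sum_insert (by decide),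
      Finset.sum_insert (by decide), Finset.sum_singleton, h0] at h
    rw [e, hz, hz]
    rw [show supportFunction K s - (u 1 s + u (-1) s) - (supportFunction K t - (u 1 t + u (-1) t)) =
      supportFunction K s - supportFunction K t -
        (u (-1) s - u (-1) t + (u 0 t - u 0 t + (u 1 s - u 1 t))) by ring]
    exact h

end SupportData

/-! ### Comparison with disks: circumradius, inradius and extremal curvature radii -/

/-- Sturm-type comparison: a periodic solution of `u + u'' ≥ 0` with a double zero is
nonnegative. -/
theorem nonneg_of_add_deriv2_nonneg {u u' u'' : ℝ → ℝ} {a : ℝ} (h1 : ∀ t, HasDerivAt u (u' t) t)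
    (h2 : ∀ t, HasDerivAt u' (u'' t) t) (hu : u a = 0) (hu' : u' a = 0)
    (hnn : ∀ t, 0 ≤ u t + u'' t) (hper : Function.Periodic u (2 * π)) (t : ℝ) : 0 ≤ u t := by
  -- Within distance `π` of `a`, `sin (y - s)` keeps one sign for `s` between `a` and `y`.
  obtain ⟨y, hy, hty⟩ := hper.exists_mem_Ico two_pi_pos t (a - π)
  rw [hty]
  clear hty t
  -- Variation of constants: `F` vanishes at `a`, equals `u y` at `y`, and its derivative is `(u +
  -- u'') sin (y - s)`.
  set F : ℝ → ℝ := fun s => u' s * sin (y - s) + u s * cos (y - s) with hF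
  have hFd : ∀ s, HasDerivAt F ((u s + u'' s) * sin (y - s)) s := by
    intro s
    have e : HasDerivAt (fun s => y - s) (-1) s := by simpa using (hasDerivAt_id s).const_sub y
    refine (((h2 s).fun_mul e.sin).fun_add ((h1 s).fun_mul e.cos)).congr_deriv ?_
    ring
  have hFa : F a = 0 := by simp [hF, hu, hu']
  have hFy : F y = u y := by simp [hF]
  have hFc : Continuous F := continuous_iff_continuousAt.2 fun s => (hFd s).continuousAt
  rw [← hFy, ← hFa]
  rcases le_total a y with h | h
  · refine monotoneOn_of_hasDerivWithinAt_nonneg (convex_Icc a y) hFc.continuousOn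
      (fun s _ => (hFd s).hasDerivWithinAt) (fun s hs => ?_) (left_mem_Icc.2 h)
      (right_mem_Icc.2 h) h
    rw [interior_Icc] at hs
    exact mul_nonneg (hnn s) (sin_nonneg_of_nonneg_of_le_pi (by linarith [hs.2])
      (by linarith [hs.1, hy.2]))
  · refine antitoneOn_of_hasDerivWithinAt_nonpos (convex_Icc y a) hFc.continuousOn
      (fun s _ => (hFd s).hasDerivWithinAt) (fun s hs => ?_) (left_mem_Icc.2 h)
      (right_mem_Icc.2 h) h
    rw [interior_Icc] at hs
    exact mul_nonpos_of_nonneg_of_nonpos (hnn s)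
      (sin_nonpos_of_nonpos_of_neg_pi_le (by linarith [hs.1]) (by linarith [hs.2, hy.1]))

theorem le_of_closedBall_subset_closedBall {z w : Plane} {r R : ℝ} (hr : 0 ≤ r)
    (h : Metric.closedBall z r ⊆ Metric.closedBall w R) : r ≤ R := by
  have h1 : z + r • outwardNormal 0 ∈ Metric.closedBall w R := h (by
    rw [Metric.mem_closedBall, dist_self_add_left, norm_smul_outwardNormal, abs_of_nonneg hr])
  have h2 : z - r • outwardNormal 0 ∈ Metric.closedBall w R := h (by
    rw [Metric.mem_closedBall, dist_self_sub_left, norm_smul_outwardNormal, abs_of_nonneg hr])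
  have h3 := dist_triangle_right (z + r • outwardNormal 0) (z - r • outwardNormal 0) w
  have h4 : dist (z + r • outwardNormal 0) (z - r • outwardNormal 0) = 2 * r := by
    rw [dist_eq_norm, show z + r • outwardNormal 0 - (z - r • outwardNormal 0) =
      (2 * r) • outwardNormal 0 by module, norm_smul_outwardNormal, abs_of_nonneg (by linarith)]
  rw [Metric.mem_closedBall] at h1 h2
  linarith

theorem circumradius_le {K : Set Plane} {z : Plane} {R : ℝ} (hR : 0 ≤ R)
    (h : K ⊆ Metric.closedBall z R) : circumradius K ≤ R :=
  csInf_le ⟨0, fun _ hr => hr.1⟩ ⟨hR, z, h⟩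

theorem le_inradius {K : Set Plane} (hK : Bornology.IsBounded K) {z : Plane} {r : ℝ} (hr : 0 ≤ r)
    (h : Metric.closedBall z r ⊆ K) : r ≤ inradius K := by
  obtain ⟨R, hR⟩ := hK.subset_closedBall 0
  refine le_csSup ⟨R, ?_⟩ ⟨hr, z, h⟩
  rintro s ⟨hs, w, hw⟩
  exact le_of_closedBall_subset_closedBall hs (hw.trans hR)

theorem inradius_nonneg (K : Set Plane) : 0 ≤ inradius K := Real.sSup_nonneg fun _ hr => hr.1

theorem inradius_le_circumradius {K : Set Plane} (hK : Bornology.IsBounded K)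
    (hne : K.Nonempty) : inradius K ≤ circumradius K := by
  obtain ⟨x, hx⟩ := hne
  obtain ⟨R, hR⟩ := hK.subset_closedBall x
  refine csSup_le ⟨0, le_rfl, x, by simpa using hx⟩ ?_
  rintro r ⟨hr, z, hz⟩
  refine le_csInf ⟨R, ?_, x, hR⟩ ?_
  · simpa using dist_nonneg.trans (hR hx)
  · rintro s ⟨-, w, hw⟩
    exact le_of_closedBall_subset_closedBall hr (hz.trans hw)

theorem inner_sub_outwardNormal_le (x z : Plane) (θ : ℝ) :
    inner ℝ x (outwardNormal θ) - inner ℝ z (outwardNormal θ) ≤ ‖x - z‖ := by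
  rw [← inner_sub_left]
  simpa using real_inner_le_norm (x - z) (outwardNormal θ)

namespace SupportData

variable {K : Set Plane} (S : SupportData K)
include S

theorem subset_closedBall {z : Plane} {R : ℝ}
    (h : ∀ θ, supportFunction K θ - inner ℝ z (outwardNormal θ) ≤ R) :
    K ⊆ Metric.closedBall z R := by
  intro x hx
  obtain ⟨θ, hθ⟩ := exists_eq_norm_smul_outwardNormal (x - z)
  have h1 : inner ℝ (x - z) (outwardNormal θ) = ‖x - z‖ := by
    conv_lhs => rw [hθ]
    rw [inner_smul_left, real_inner_self_eq_norm_sq, norm_outwardNormal]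
    simp
  rw [inner_sub_left] at h1
  rw [Metric.mem_closedBall, dist_eq_norm]
  linarith [h θ, S.le_support θ x hx]

/-- A point of the ball outside `K` would be strictly separated from it, contradicting the bound in
the separating direction. -/
theorem closedBall_subset (hconv : Convex ℝ K) (hcl : IsClosed K) {z : Plane} {r : ℝ}
    (h : ∀ θ, r ≤ supportFunction K θ - inner ℝ z (outwardNormal θ)) :
    Metric.closedBall z r ⊆ K := by
  intro x hx
  by_contra hxK
  obtain ⟨f, c, hfx, hfK⟩ := geometric_hahn_banach_point_closed hconv hcl hxK
  set v : Plane := (InnerProductSpace.toDual ℝ Plane).symm f with hv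
  have hfv : ∀ y, f y = inner ℝ y v := fun y => by
    rw [real_inner_comm, hv, InnerProductSpace.toDual_symm_apply]
  obtain ⟨θ, hθ⟩ := exists_eq_norm_smul_outwardNormal (-v)
  have hfθ : ∀ y, f y = -(‖-v‖ * inner ℝ y (outwardNormal θ)) := fun y => by
    rw [hfv, ← neg_neg (inner ℝ y v), ← inner_neg_right]
    conv_lhs => rw [hθ]
    rw [inner_smul_right]
  have h1 := hfx.trans (hfK _ (S.boundaryCurve_mem hcl θ))
  rw [hfθ, hfθ, S.inner_boundaryCurve] at h1
  have h2 := inner_sub_outwardNormal_le x z θ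
  rw [Metric.mem_closedBall, dist_eq_norm] at hx
  have h3 : inner ℝ x (outwardNormal θ) ≤ supportFunction K θ := by linarith [h θ]
  have := mul_le_mul_of_nonneg_left h3 (norm_nonneg (-v))
  linarith

/-- Blaschke's rolling argument. The disk of radius `R` tangent to `K` at normal angle `0` gives a
difference `u` of support functions with a double zero there and `u + u'' = R - ρ ≥ 0`. -/
theorem exists_support_sub_inner_le {R : ℝ} (hR : ∀ θ, rho K θ ≤ R) :
    ∃ z : Plane, ∀ θ, supportFunction K θ - inner ℝ z (outwardNormal θ) ≤ R := by
  set z := boundaryCurve K 0 - R • outwardNormal 0 with hz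
  have hd := fun θ => (hasDerivAt_const θ z).inner ℝ (hasDerivAt_outwardNormal θ)
  have hd2 := fun θ => (hasDerivAt_const θ z).inner ℝ (hasDerivAt_unitTangent θ)
  simp only [inner_zero_left, add_zero] at hd hd2
  refine ⟨z, fun θ => ?_⟩
  have := nonneg_of_add_deriv2_nonneg (a := 0)
    (u := fun θ => R - (supportFunction K θ - inner ℝ z (outwardNormal θ)))
    (fun θ => ((S.hasDerivAt_iterate 0 θ).fun_sub (hd θ)).const_sub R)
    (fun θ => ((S.hasDerivAt_iterate 1 θ).fun_sub (hd2 θ)).fun_neg) ?_ ?_ (fun θ => ?_)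
    (fun θ => ?_) θ
  · linarith
  · simp [hz, inner_plane, boundaryCurve, outwardNormal]
  · simp [hz, inner_plane, boundaryCurve, outwardNormal, unitTangent]
  · have := hR θ
    rw [S.rho_eq, Function.iterate_zero, id_eq] at this
    simp only [inner_neg_right, Nat.reduceAdd]
    linarith
  · simp only [S.periodic θ, outwardNormal_periodic θ]

theorem exists_le_support_sub_inner {r : ℝ} (hr : ∀ θ, r ≤ rho K θ) :
    ∃ z : Plane, ∀ θ, r ≤ supportFunction K θ - inner ℝ z (outwardNormal θ) := by
  set z := boundaryCurve K 0 - r • outwardNormal 0 with hz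
  have hd := fun θ => (hasDerivAt_const θ z).inner ℝ (hasDerivAt_outwardNormal θ)
  have hd2 := fun θ => (hasDerivAt_const θ z).inner ℝ (hasDerivAt_unitTangent θ)
  simp only [inner_zero_left, add_zero] at hd hd2
  refine ⟨z, fun θ => ?_⟩
  have := nonneg_of_add_deriv2_nonneg (a := 0)
    (u := fun θ => supportFunction K θ - inner ℝ z (outwardNormal θ) - r)
    (fun θ => ((S.hasDerivAt_iterate 0 θ).fun_sub (hd θ)).sub_const r)
    (fun θ => (S.hasDerivAt_iterate 1 θ).fun_sub (hd2 θ)) ?_ ?_ (fun θ => ?_)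
    (fun θ => ?_) θ
  · linarith
  · simp [hz, inner_plane, boundaryCurve, outwardNormal]
  · simp [hz, inner_plane, boundaryCurve, outwardNormal, unitTangent]
  · have := hr θ
    rw [S.rho_eq, Function.iterate_zero, id_eq] at this
    simp only [inner_neg_right, Nat.reduceAdd]
    linarith
  · simp only [S.periodic θ, outwardNormal_periodic θ]

theorem isCompact_rho_image : IsCompact (rho K '' Icc 0 (2 * π)) :=
  isCompact_Icc.image S.continuous_rho

theorem rho_mem_image (θ : ℝ) : rho K θ ∈ rho K '' Icc 0 (2 * π) := by
  obtain ⟨s, hs, hst⟩ := S.periodic_rho.exists_mem_Ico₀ two_pi_pos θ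
  exact ⟨s, Ico_subset_Icc_self hs, hst.symm⟩

theorem rho_le_rhoMax (θ : ℝ) : rho K θ ≤ rhoMax K :=
  le_csSup S.isCompact_rho_image.bddAbove (S.rho_mem_image θ)

theorem rhoMin_le_rho (θ : ℝ) : rhoMin K ≤ rho K θ :=
  csInf_le S.isCompact_rho_image.bddBelow (S.rho_mem_image θ)

theorem rhoMin_nonneg : 0 ≤ rhoMin K := by
  refine Real.sInf_nonneg ?_
  rintro _ ⟨θ, -, rfl⟩
  exact (S.rho_pos θ).le

theorem circumradius_le_rhoMax : circumradius K ≤ rhoMax K := by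
  obtain ⟨z, hz⟩ := S.exists_support_sub_inner_le S.rho_le_rhoMax
  exact circumradius_le ((S.rho_pos 0).le.trans (S.rho_le_rhoMax 0)) (S.subset_closedBall hz)

theorem rhoMin_le_inradius (hconv : Convex ℝ K) (hcomp : IsCompact K) :
    rhoMin K ≤ inradius K := by
  obtain ⟨z, hz⟩ := S.exists_le_support_sub_inner S.rhoMin_le_rho
  exact le_inradius hcomp.isBounded S.rhoMin_nonneg
    (S.closedBall_subset hconv hcomp.isClosed hz)

/-- The maximum and minimum of the support function about one center are radii of concentric disks
around and inside `K`, so their difference bounds `ρ_e - ρ_i`. -/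
theorem sq_circumradius_sub_inradius_le (hconv : Convex ℝ K) (hcomp : IsCompact K) :
    (circumradius K - inradius K) ^ 2 ≤ 9 / 10 * (meanSq K 2 - meanSq K 1) := by
  have hne : K.Nonempty := ⟨_, S.boundaryCurve_mem hcomp.isClosed 0⟩
  obtain ⟨z, hz⟩ := S.exists_center_sq_sub_le
  set q : ℝ → ℝ := fun θ => supportFunction K θ - inner ℝ z (outwardNormal θ) with hq
  have hqc : Continuous q := (S.continuous_iterate 0).sub
    (continuous_const.inner contDiff_outwardNormal.continuous)
  have hqp : Function.Periodic q (2 * π) := fun θ => by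
    simp only [hq, S.periodic θ, outwardNormal_periodic θ]
  have hnI : (Icc 0 (2 * π)).Nonempty := nonempty_Icc.2 two_pi_pos.le
  obtain ⟨s, -, hs⟩ := isCompact_Icc.exists_isMaxOn hnI hqc.continuousOn
  obtain ⟨t, -, ht⟩ := isCompact_Icc.exists_isMinOn hnI hqc.continuousOn
  have hs' : ∀ θ, q θ ≤ q s := fun θ => by
    obtain ⟨y, hy, e⟩ := hqp.exists_mem_Ico₀ two_pi_pos θ
    rw [e]; exact hs (Ico_subset_Icc_self hy)
  have ht' : ∀ θ, q t ≤ q θ := fun θ => by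
    obtain ⟨y, hy, e⟩ := hqp.exists_mem_Ico₀ two_pi_pos θ
    rw [e]; exact ht (Ico_subset_Icc_self hy)
  have hsub := S.subset_closedBall hs'
  have hqs : 0 ≤ q s := by
    obtain ⟨x, hx⟩ := hne
    exact dist_nonneg.trans (hsub hx)
  have h1 := circumradius_le hqs hsub
  have h2 : q t ≤ inradius K := by
    -- If the chosen center lies outside `K`, the minimum is negative and `0 ≤ ρ_i` is enough.
    rcases le_total 0 (q t) with h | h
    · exact le_inradius hcomp.isBounded h (S.closedBall_subset hconv hcomp.isClosed ht')
    · exact h.trans (inradius_nonneg K)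
  have h3 := inradius_le_circumradius hcomp.isBounded hne
  have h4 := hz s t (sub_nonneg.2 (ht' s))
  calc (circumradius K - inradius K) ^ 2 ≤ (q s - q t) ^ 2 :=
        pow_le_pow_left₀ (sub_nonneg.2 h3) (by linarith) 2
    _ ≤ _ := h4

/-- A domain whose boundary has constant curvature radius is a disk. -/
theorem isDisk_of_rho_eq_const (hconv : Convex ℝ K) (hcl : IsClosed K) {r : ℝ}
    (h : ∀ θ, rho K θ = r) : IsDisk K := by
  have hq : ∀ θ, deriv^[1] (supportFunction K) θ + deriv^[3] (supportFunction K) θ = 0 := by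
    intro θ
    rw [← (S.hasDerivAt_rho θ).deriv, funext h, deriv_const]
  -- The evolute is stationary, and its single point is the center of the disk.
  have hev : ∀ θ, HasDerivAt (evolute K) 0 θ := fun θ => by
    simpa only [hq, neg_zero, zero_smul] using S.hasDerivAt_evolute θ
  have hconst := fun θ => is_const_of_deriv_eq_zero (fun θ => (hev θ).differentiableAt)
    (fun θ => (hev θ).deriv) θ 0
  have hs : ∀ θ, supportFunction K θ - inner ℝ (evolute K 0) (outwardNormal θ) = r := by
    intro θ
    rw [← hconst θ, evolute, h, inner_add_left, S.inner_boundaryCurve, inner_smul_left,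
      inner_neg_left, real_inner_self_eq_norm_sq, norm_outwardNormal]
    simp
  exact ⟨evolute K 0, r, h 0 ▸ S.rho_pos 0, (S.subset_closedBall fun θ => (hs θ).le).antisymm
    (S.closedBall_subset hconv hcl fun θ => (hs θ).ge)⟩

/-- The boundary of a disk has constant curvature radius. -/
theorem exists_rho_eq_const_of_isDisk (h : IsDisk K) : ∃ r, ∀ θ, rho K θ = r := by
  obtain ⟨z, r, hr, rfl⟩ := h
  have hsup : supportFunction (Metric.closedBall z r) =
      fun θ => inner ℝ z (outwardNormal θ) + r := by
    ext θ
    refine IsGreatest.csSup_eq ⟨⟨z + r • outwardNormal θ, ?_, ?_⟩, ?_⟩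
    · rw [Metric.mem_closedBall, dist_self_add_left, norm_smul_outwardNormal, abs_of_pos hr]
    · simp only [inner_add_left, inner_smul_left, real_inner_self_eq_norm_sq, norm_outwardNormal]
      simp
    · rintro _ ⟨x, hx, rfl⟩
      rw [Metric.mem_closedBall, dist_eq_norm] at hx
      have := inner_sub_outwardNormal_le x z θ
      simp only
      linarith
  have hd := fun θ => (hasDerivAt_const θ z).inner ℝ (hasDerivAt_outwardNormal θ)
  have hd2 := fun θ => (hasDerivAt_const θ z).inner ℝ (hasDerivAt_unitTangent θ)
  simp only [inner_zero_left, add_zero] at hd hd2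
  refine ⟨r, fun θ => ?_⟩
  have h1 : deriv (supportFunction (Metric.closedBall z r)) = fun θ => inner ℝ z (unitTangent θ) :=
    funext fun θ => by
      rw [hsup]
      exact ((hd θ).add_const r).deriv
  rw [S.rho_eq]
  simp only [Function.iterate_succ, Function.iterate_zero, Function.comp_apply, id_eq]
  rw [h1, (hd2 θ).deriv, hsup, inner_neg_right]
  ring

end SupportData

theorem intRhoSq_of_rho_eq_const {K : Set Plane} {r : ℝ} (h : ∀ θ, rho K θ = r) :
    intRhoSq K = 2 * π * r ^ 2 := by
  simp [intRhoSq, h]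

namespace SupportData

variable {K : Set Plane} (S : SupportData K)
include S

theorem deriv_radius_eq_zero_of_rho_eq_const {r : ℝ} (h : ∀ θ, rho K θ = r) (θ : ℝ) :
    deriv^[1] (supportFunction K) θ + deriv^[3] (supportFunction K) θ = 0 := by
  rw [← (S.hasDerivAt_rho θ).deriv, funext h, deriv_const]

theorem evoluteArea_eq_zero_of_rho_eq_const {r : ℝ} (h : ∀ θ, rho K θ = r) :
    evoluteArea K = 0 := by
  have hev : ∀ θ, deriv (evolute K) θ = 0 := fun θ => by
    rw [(S.hasDerivAt_evolute θ).deriv, S.deriv_radius_eq_zero_of_rho_eq_const h, neg_zero,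
      zero_smul]
  simp [evoluteArea, orientedArea, hev]

theorem intRhoBetaSq_eq_zero_of_rho_eq_const {r : ℝ} (h : ∀ θ, rho K θ = r) :
    intRhoBetaSq K = 0 := by
  rw [intRhoBetaSq]
  simp only [S.rhoBeta_sq, S.deriv_radius_eq_zero_of_rho_eq_const h]
  simp

theorem perimeter_of_rho_eq_const {r : ℝ} (h : ∀ θ, rho K θ = r) :
    perimeter K = 2 * π * r := by
  simp [S.perimeter_eq_integral_rho, h]

theorem area_of_rho_eq_const (hconv : Convex ℝ K) (hcomp : IsCompact K)
    (hint : (interior K).Nonempty) {r : ℝ} (h : ∀ θ, rho K θ = r) : area K = π * r ^ 2 := by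
  have hL := S.perimeter_of_rho_eq_const h
  rw [S.perimeter_eq, Function.iterate_zero, id_eq] at hL
  rw [S.area_eq hconv hcomp hint]
  simp only [h]
  rw [intervalIntegral.integral_mul_const, hL]
  ring

/-! ### The four inequalities and their equality cases -/

/-- The isoperimetric inequality by Hurwitz's method, with polynomial `m - 1`. -/
theorem four_pi_mul_area_le (hconv : Convex ℝ K) (hcomp : IsCompact K)
    (hint : (interior K).Nonempty) : 4 * π * area K ≤ perimeter K ^ 2 := by
  have h := S.coeff_zero_le_meanSq (a₀ := -1) (a₁ := 1) (a₂ := 0) (a₃ := 0)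
    (by rintro m (rfl | h) <;> linarith)
  rw [S.area_eq_meanSq hconv hcomp hint, S.perimeter_sq]
  nlinarith [sq_nonneg π]

/-- Already `20 A ≤ (5/3) L² < 2 L²`; the remaining terms are only used as nonnegative. -/
theorem twenty_mul_area_lt (hconv : Convex ℝ K) (hcomp : IsCompact K)
    (hint : (interior K).Nonempty) : 20 * area K <
      2 * perimeter K ^ 2 + 8 * |evoluteArea K| + 2 * intRhoBetaSq K + intKappaSq K := by
  have h1 := S.four_pi_mul_area_le hconv hcomp hint
  have h2 := intRhoBetaSq_nonneg K
  have h3 := intKappaSq_nonneg K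
  have h4 := abs_nonneg (evoluteArea K)
  have h5 : 0 < perimeter K ^ 2 := by have := S.perimeter_pos; positivity
  have h6 : 0 ≤ area K := measureReal_nonneg
  have h7 : 12 * area K ≤ perimeter K ^ 2 := by nlinarith [pi_gt_three]
  linarith

theorem perimeter_sq_le_rhoSq_three (hconv : Convex ℝ K) (hcomp : IsCompact K)
    (hint : (interior K).Nonempty) :
    (8 * π - 8) / π * perimeter K ^ 2 + (8 - 2 * π) * |evoluteArea K| ≤
      3 * intRhoSq K + (32 * π - 38) * area K + (π - 1) * intRhoBetaSq K := by
  -- The coefficients are those of the difference of the two sides divided by `π`. The polynomial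
  -- vanishes at `m = 1` and `m = 4`, so the harmonics `|n| ≤ 2` contribute nothing.
  have h := S.coeff_zero_le_meanSq (a₀ := 32 * (π - 1)) (a₁ := -32 * (π - 1)) (a₂ := -2 * (π - 1))
    (a₃ := 2 * (π - 1)) (by
      have hπ := pi_gt_three
      intro m hm
      rw [show 32 * (π - 1) + -32 * (π - 1) * m + -2 * (π - 1) * m ^ 2 + 2 * (π - 1) * m ^ 3 =
        2 * (π - 1) * ((m - 1) * (m ^ 2 - 16)) by ring]
      refine mul_nonneg (by linarith) ?_
      rcases hm with rfl | hm
      · simp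
      · exact mul_nonneg (by linarith) (by nlinarith))
  have e : (8 * π - 8) / π * perimeter K ^ 2 = π * (32 * (π - 1) * ‖supportCoeff K 0‖ ^ 2) := by
    have := pi_pos
    rw [S.perimeter_sq]
    field_simp
    ring
  rw [e, S.abs_evoluteArea_eq, S.intRhoSq_eq, S.intRhoBetaSq_eq,
    S.area_eq_meanSq hconv hcomp hint]
  have := mul_le_mul_of_nonneg_left h pi_pos.le
  linarith

theorem perimeter_sq_le_rhoSq (hconv : Convex ℝ K) (hcomp : IsCompact K)
    (hint : (interior K).Nonempty) :
    13 / 7 * perimeter K ^ 2 + π / 7 * |evoluteArea K| ≤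
      intRhoSq K + (52 * π / 7 - 2) * area K + 3 / 4 * intRhoBetaSq K := by
  have h := S.coeff_zero_le_meanSq (a₀ := 52 * π / 7) (a₁ := -1 / 2 - 51 * π / 7)
    (a₂ := -1 - π / 7) (a₃ := 3 / 2) (by
      have hπ := pi_lt_d2
      have hπ0 := pi_pos
      intro m hm
      rw [show 52 * π / 7 + (-1 / 2 - 51 * π / 7) * m + (-1 - π / 7) * m ^ 2 + 3 / 2 * m ^ 3 =
        (m - 1) * (3 / 2 * m ^ 2 + (1 / 2 - π / 7) * m - 52 * π / 7) by ring]
      rcases hm with rfl | hm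
      · simp
      · refine mul_nonneg (by linarith) ?_
        -- Linearizing at `m = 4` reduces the claim to `26 ≥ 8π`.
        have h2 : 6 * m ≤ 3 / 2 * m ^ 2 := by nlinarith
        have h3 : (13 / 2 - π / 7) * 4 ≤ (13 / 2 - π / 7) * m :=
          mul_le_mul_of_nonneg_left hm (by linarith)
        linarith)
  have e : 13 / 7 * perimeter K ^ 2 = π * (52 * π / 7 * ‖supportCoeff K 0‖ ^ 2) := by
    rw [S.perimeter_sq]
    ring
  rw [e, S.abs_evoluteArea_eq, S.intRhoSq_eq, S.intRhoBetaSq_eq,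
    S.area_eq_meanSq hconv hcomp hint]
  have := mul_le_mul_of_nonneg_left h pi_pos.le
  linarith

theorem sq_circumradius_sub_inradius_le_evoluteArea (hconv : Convex ℝ K) (hcomp : IsCompact K) :
    10 / 9 * (π * (circumradius K - inradius K) ^ 2) ≤ |evoluteArea K| := by
  rw [S.abs_evoluteArea_eq]
  have := mul_le_mul_of_nonneg_left (S.sq_circumradius_sub_inradius_le hconv hcomp) pi_pos.le
  linarith

theorem sq_circumradius_sub_inradius_le_rhoMax_sub_rhoMin (hconv : Convex ℝ K)
    (hcomp : IsCompact K) :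
    (circumradius K - inradius K) ^ 2 ≤ (rhoMax K - rhoMin K) ^ 2 := by
  have h1 := inradius_le_circumradius hcomp.isBounded ⟨_, S.boundaryCurve_mem hcomp.isClosed 0⟩
  have h2 := S.circumradius_le_rhoMax
  have h3 := S.rhoMin_le_inradius hconv hcomp
  exact pow_le_pow_left₀ (sub_nonneg.2 h1) (by linarith) 2

theorem circumradius_sub_inradius_bound (hconv : Convex ℝ K) (hcomp : IsCompact K) {ε : ℝ}
    (hε : 0 ≤ ε) : 2 * π * (circumradius K - inradius K) ^ 2 ≤
      |evoluteArea K| + ε * intRhoBetaSq K + π * (rhoMax K - rhoMin K) ^ 2 := by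
  have h1 := S.sq_circumradius_sub_inradius_le_evoluteArea hconv hcomp
  have h2 := mul_le_mul_of_nonneg_left
    (S.sq_circumradius_sub_inradius_le_rhoMax_sub_rhoMin hconv hcomp) pi_pos.le
  have h3 := mul_nonneg hε (intRhoBetaSq_nonneg K)
  have h4 : 0 ≤ π * (circumradius K - inradius K) ^ 2 := by positivity
  linarith

theorem circumradius_sub_inradius_bound_eq_iff (hconv : Convex ℝ K) (hcomp : IsCompact K) {ε : ℝ}
    (hε : 0 ≤ ε) : |evoluteArea K| + ε * intRhoBetaSq K + π * (rhoMax K - rhoMin K) ^ 2 =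
      2 * π * (circumradius K - inradius K) ^ 2 ↔ IsDisk K := by
  constructor
  · intro heq
    have h1 := S.sq_circumradius_sub_inradius_le_evoluteArea hconv hcomp
    have h2 := mul_le_mul_of_nonneg_left
      (S.sq_circumradius_sub_inradius_le_rhoMax_sub_rhoMin hconv hcomp) pi_pos.le
    have h3 := mul_nonneg hε (intRhoBetaSq_nonneg K)
    have h4 : 0 ≤ π * (circumradius K - inradius K) ^ 2 := by positivity
    -- The lower bounds add up to `(19/9) π (ρ_e - ρ_i)²` against `2π (ρ_e - ρ_i)²`, so `ρ_e = ρ_i`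
    -- and the right side of the equality is zero.
    have h5 : π * (rhoMax K - rhoMin K) ^ 2 ≤ 0 := by linarith
    have h6 : (rhoMax K - rhoMin K) ^ 2 ≤ 0 := nonpos_of_mul_nonpos_right h5 pi_pos
    have h7 : rhoMax K - rhoMin K = 0 := pow_eq_zero_iff two_ne_zero |>.1
      (le_antisymm h6 (sq_nonneg _))
    exact S.isDisk_of_rho_eq_const hconv hcomp.isClosed (r := rhoMin K) fun θ =>
      le_antisymm (by linarith [S.rho_le_rhoMax θ]) (S.rhoMin_le_rho θ)
  · intro hdisk
    obtain ⟨r, hr⟩ := S.exists_rho_eq_const_of_isDisk hdisk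
    have himg : rho K '' Icc 0 (2 * π) = {r} := by
      rw [image_congr fun θ _ => hr θ]
      exact (nonempty_Icc.2 two_pi_pos.le).image_const r
    have h0 : |evoluteArea K| + ε * intRhoBetaSq K + π * (rhoMax K - rhoMin K) ^ 2 = 0 := by
      rw [S.evoluteArea_eq_zero_of_rho_eq_const hr, S.intRhoBetaSq_eq_zero_of_rho_eq_const hr,
        rhoMax, rhoMin, himg]
      simp
    have hle := S.circumradius_sub_inradius_bound hconv hcomp hε
    have hnn : 0 ≤ 2 * π * (circumradius K - inradius K) ^ 2 := by positivity
    linarith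

theorem eq_of_isDisk (hconv : Convex ℝ K) (hcomp : IsCompact K) (hint : (interior K).Nonempty)
    (hdisk : IsDisk K) :
    3 * intRhoSq K + (32 * π - 38) * area K + (π - 1) * intRhoBetaSq K =
        (8 * π - 8) / π * perimeter K ^ 2 + (8 - 2 * π) * |evoluteArea K| ∧
      intRhoSq K + (52 * π / 7 - 2) * area K + 3 / 4 * intRhoBetaSq K =
        13 / 7 * perimeter K ^ 2 + π / 7 * |evoluteArea K| := by
  obtain ⟨r, hr⟩ := S.exists_rho_eq_const_of_isDisk hdisk
  rw [S.evoluteArea_eq_zero_of_rho_eq_const hr, S.intRhoBetaSq_eq_zero_of_rho_eq_const hr,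
    S.area_of_rho_eq_const hconv hcomp hint hr, S.perimeter_of_rho_eq_const hr,
    intRhoSq_of_rho_eq_const hr, abs_zero]
  have := pi_pos
  constructor
  · field_simp
    ring
  · ring

end SupportData

end PlaneConvex

end

theorem corollary3 (K : Set Plane) (hK : IsSmoothStrictlyConvexDomain K) :
    -- the four inequalities
    (2 * perimeter K ^ 2 + 8 * |evoluteArea K| + 2 * intRhoBetaSq K + intKappaSq K ≥ 20 * area K ∧
      3 * intRhoSq K + (32 * π - 38) * area K + (π - 1) * intRhoBetaSq K ≥
        (8 * π - 8) / π * perimeter K ^ 2 + (8 - 2 * π) * |evoluteArea K| ∧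
      intRhoSq K + (52 * π / 7 - 2) * area K + 3 / 4 * intRhoBetaSq K ≥
        13 / 7 * perimeter K ^ 2 + π / 7 * |evoluteArea K| ∧
      ∀ ε ∈ Icc (0 : ℝ) (1 / 2),
        |evoluteArea K| + ε * intRhoBetaSq K + π * (rhoMax K - rhoMin K) ^ 2 ≥
          2 * π * (circumradius K - inradius K) ^ 2) ∧
    -- the first one is strict
    2 * perimeter K ^ 2 + 8 * |evoluteArea K| + 2 * intRhoBetaSq K + intKappaSq K > 20 * area K ∧
    -- equality in the second and the third one for disks
    (IsDisk K →
      3 * intRhoSq K + (32 * π - 38) * area K + (π - 1) * intRhoBetaSq K =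
        (8 * π - 8) / π * perimeter K ^ 2 + (8 - 2 * π) * |evoluteArea K| ∧
      intRhoSq K + (52 * π / 7 - 2) * area K + 3 / 4 * intRhoBetaSq K =
        13 / 7 * perimeter K ^ 2 + π / 7 * |evoluteArea K|) ∧
    -- equality in the fourth one exactly for disks
    ∀ ε ∈ Icc (0 : ℝ) (1 / 2),
      (|evoluteArea K| + ε * intRhoBetaSq K + π * (rhoMax K - rhoMin K) ^ 2 =
          2 * π * (circumradius K - inradius K) ^ 2 ↔ IsDisk K) := by
  have S := hK.supportData
  have hconv := hK.strictConvex.convex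
  have hlt := S.twenty_mul_area_lt hconv hK.isCompact hK.nonempty_interior
  exact ⟨⟨hlt.le, S.perimeter_sq_le_rhoSq_three hconv hK.isCompact hK.nonempty_interior,
    S.perimeter_sq_le_rhoSq hconv hK.isCompact hK.nonempty_interior,
    fun ε hε => S.circumradius_sub_inradius_bound hconv hK.isCompact hε.1⟩, hlt,
    S.eq_of_isDisk hconv hK.isCompact hK.nonempty_interior,
    fun ε hε => S.circumradius_sub_inradius_bound_eq_iff hconv hK.isCompact hε.1⟩
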